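/- **Setting.** There are $N$ users, $K$ arms and $D$ objectives. At every round $t\ge 1$ each user $n\in[N]$ is offered a fixed nonempty set $\mathcal A_t^n\subseteq[K]$ of arms, and the learner pulls one arm $a_t^n\in\mathcal A_t^n$ for this user. It then observes a reward vector $\boldsymbol r_t^n\in[0,1]^D$, a fresh draw from the fixed law of the pulled arm $i=a_t^n$ (mean $\boldsymbol\mu_i$), and the user's preference vector $\boldsymbol c_t^n$, drawn from the fixed law of user $n$ on nonnegative vectors with $\|\boldsymbol c_t^n\|_1\le\delta$ (mean $\overline{\boldsymbol c}^n$). All laws are unknown to the learner, and all reward and preference vectors are mutually independent. Let $a_t^{n*}\in\arg\max_{i\in\mathcal A_t^n}\overline{\boldsymbol c}^{n\top}\boldsymbol\mu_i$, let $\eta_{i,t}^n=\overline{\boldsymbol c}^{n\top}(\boldsymbol\mu_{a_t^{n*}}-\boldsymbol\mu_i)$, and let the regret be $R(T)=\sum_{t=1}^T\sum_{n=1}^N\eta^n_{a_t^n,t}$. **Algorithm (PRUCB-UP with parameter $\alpha\in(0,1]$).** For all $t\ge1$ and $n\in[N]$, $$a_t^n\in\arg\max_{i\in\mathcal A_t^n}\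 \hat{\boldsymbol c}_t^{n\top}\Big(\hat{\boldsymbol r}_{i,t}+\sqrt{\tfrac{\log(t/\alpha)}{\max\{1,N_{i,t}\}}}\,(1,\dots,1)^\top\Big).$$ Here $\hat{\boldsymbol c}_t^n$ is the empirical mean of $\boldsymbol c_1^n,\dots,\boldsymbol c_{t-1}^n$ (and $\boldsymbol 0$ for $t=1$), $N_{i,t}$ is the number of pulls of arm $i$, over all users, before round $t$, and $\hat{\boldsymbol r}_{i,t}$ is the empirical mean of the $N_{i,t}$ corresponding rewards (and $\boldsymbol 0$ if $N_{i,t}=0$). Ties are broken by any rule that uses only earlier rounds and possibly independent randomness. **Gaps.** Let $\mathcal T_i^n=\{t\in[T]: i\in\mathcal A_t^n,\ i\text{ is not optimal in }\mathcal A_t^n\}$, and for $\mathcal T_i^n\neq\emptyset$ let $\eta_i^{n\uparrow}=\max_{t\in\mathcal T_i^n}\eta_{i,t}^n$, $\eta_i^{n\downarrow}=\min_{t\in\mathcal T_i^n}\eta_{i,t}^n>0$ and $\|\Delta_i^{n\uparrow}\|_2=\max_{t\in\mathcal T_i^n,\,j\in\mathcal A_t^n}\|\boldsymbol\mu_i-\boldsymbol\mu_j\|_2$.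 **Theorem.** There is a universal constant $C>0$ such that for all such instances, all $\alpha\in(0,1]$ and all $T\ge1$, $$\mathbb E[R(T)]\le C\sum_{n\in[N]}\ \sum_{i:\ \mathcal T_i^n\ne\emptyset}\Big(\underbrace{\frac{\delta^2\log (T/\alpha)}{\eta_i^{n\downarrow}}+D\pi^2\alpha^2\eta_i^{n\uparrow}}_{R_T^r}+\underbrace{\frac{D^2\|\Delta_i^{n\uparrow}\|_2^2\,\delta^2}{\eta_i^{n\downarrow}}}_{R_T^c}\Big),$$ and $\log(T/\alpha)$ can be replaced by $\log T$ as soon as $T\ge 1/\alpha$. Moreover, the $R_T^c$-part and the $R_T^r$-part bound the expected regret caused by preference estimation errors and by reward estimation errors, respectively. Precisely, split $R(T)$ into the sum over those pairs $(t,n)$ with $\hat{\boldsymbol c}_t^{n\top}(\boldsymbol\mu_{a_t^{n*}}-\boldsymbol\mu_{a_t^n})\le\frac12\,\overline{\boldsymbol c}^{n\top}(\boldsymbol\mu_{a_t^{n*}}-\boldsymbol\mu_{a_t^n})$ (imprecise preference estimate) and the sum over all other pairs. Then the expectation of the first sum is at most $C\sum_{n}\sum_{i:\,\mathcal T_i^n\ne\emptyset}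 D^2\|\Delta_i^{n\uparrow}\|_2^2\delta^2/\eta_i^{n\downarrow}$, which has no $\log T$ factor, and the expectation of the second is at most $C\sum_n\sum_{i:\,\mathcal T_i^n\neq\emptyset}\big(\delta^2\log(T/\alpha)/\eta_i^{n\downarrow}+D\pi^2\alpha^2\eta_i^{n\uparrow}\big)$. -/

import Mathlib

open MeasureTheory ProbabilityTheory
open scoped Matrix

noncomputable section

namespace PAMO

/-- A preference-aware multi-objective bandit instance with `N` users, `K` arms, `D` objectives.
Rewards of an arm are drawn from a fixed law on `[0,1]^D`, preferences of a user from a fixed law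
on the nonnegative vectors of `ℓ¹`-norm at most `delta`; user `n` is offered the nonempty set
`armSet t n` of arms at round `t`. -/
structure Bandit (N K D : ℕ) where
  rewardLaw : Fin K → Measure (Fin D → ℝ)
  prefLaw : Fin N → Measure (Fin D → ℝ)
  delta : ℝ
  armSet : ℕ → Fin N → Finset (Fin K)
  reward_prob : ∀ i, IsProbabilityMeasure (rewardLaw i)
  pref_prob : ∀ n, IsProbabilityMeasure (prefLaw n)
  reward_mem : ∀ i, ∀ᵐ x ∂(rewardLaw i), ∀ d, x d ∈ Set.Icc (0 : ℝ) 1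
  pref_nonneg : ∀ n, ∀ᵐ x ∂(prefLaw n), ∀ d, 0 ≤ x d
  pref_norm : ∀ n, ∀ᵐ x ∂(prefLaw n), ∑ d, |x d| ≤ delta
  armSet_nonempty : ∀ t n, (armSet t n).Nonempty

variable {N K D : ℕ}

/-- The mean reward vector `μ_i` of arm `i`. -/
def Bandit.meanReward (I : Bandit N K D) (i : Fin K) : Fin D → ℝ :=
  fun d => ∫ x, x d ∂(I.rewardLaw i)

/-- The mean preference vector of user `n`. -/
def Bandit.meanPref (I : Bandit N K D) (n : Fin N) : Fin D → ℝ :=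
  fun d => ∫ x, x d ∂(I.prefLaw n)

/-- `i` is an optimal arm for user `n` at round `t`. -/
def Bandit.IsBestArm (I : Bandit N K D) (t : ℕ) (n : Fin N) (i : Fin K) : Prop :=
  i ∈ I.armSet t n ∧
    ∀ j ∈ I.armSet t n, I.meanPref n ⬝ᵥ I.meanReward j ≤ I.meanPref n ⬝ᵥ I.meanReward i

/-- The expected overall-reward gap of arm `i` for user `n` at round `t`, relative to the
optimal arm `best t n`. -/
def Bandit.gap (I : Bandit N K D) (best : ℕ → Fin N → Fin K) (t : ℕ) (n : Fin N) (i : Fin K) : ℝ :=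
  I.meanPref n ⬝ᵥ (I.meanReward (best t n) - I.meanReward i)

/-- The rounds `t ∈ {1,…,T}` at which arm `i` is offered to user `n` and is suboptimal. -/
def Bandit.subRounds (I : Bandit N K D) (best : ℕ → Fin N → Fin K) (T : ℕ) (n : Fin N)
    (i : Fin K) : Finset ℕ :=
  {t ∈ Finset.Icc 1 T | i ∈ I.armSet t n ∧ 0 < I.gap best t n i}

/-- The largest gap `η_i^{n↑}` (used only if `subRounds` is nonempty). -/
def Bandit.gapMax (I : Bandit N K D) (best : ℕ → Fin N → Fin K) (T : ℕ) (n : Fin N)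
    (i : Fin K) : ℝ :=
  sSup ((fun t => I.gap best t n i) '' (I.subRounds best T n i : Set ℕ))

/-- The smallest gap `η_i^{n↓}` (used only if `subRounds` is nonempty). -/
def Bandit.gapMin (I : Bandit N K D) (best : ℕ → Fin N → Fin K) (T : ℕ) (n : Fin N)
    (i : Fin K) : ℝ :=
  sInf ((fun t => I.gap best t n i) '' (I.subRounds best T n i : Set ℕ))

/-- The largest Euclidean distance `‖Δ_i^{n↑}‖₂` between the mean reward of `i` and that of an arm
offered together with it when `i` is suboptimal (used only if `subRounds` is nonempty). -/
def Bandit.distMax (I : Bandit N K D) (best : ℕ → Fin N → Fin K) (T : ℕ) (n : Fin N)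
    (i : Fin K) : ℝ :=
  sSup {x | ∃ t ∈ I.subRounds best T n i, ∃ j ∈ I.armSet t n,
    x = ‖WithLp.toLp 2 (I.meanReward i - I.meanReward j)‖}

/-- The part of the regret bound that is due to reward estimation, `L` being the logarithmic
factor. Pairs `(n, i)` for which `i` is never suboptimal contribute nothing. -/
def Bandit.rewardBound (I : Bandit N K D) (best : ℕ → Fin N → Fin K) (T : ℕ) (α L : ℝ) : ℝ :=
  ∑ n : Fin N, ∑ i : Fin K with (I.subRounds best T n i).Nonempty,
    (I.delta ^ 2 * L / I.gapMin best T n i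
      + (D : ℝ) * Real.pi ^ 2 * α ^ 2 * I.gapMax best T n i)

/-- The part of the regret bound that is due to preference estimation. -/
def Bandit.prefBound (I : Bandit N K D) (best : ℕ → Fin N → Fin K) (T : ℕ) : ℝ :=
  ∑ n : Fin N, ∑ i : Fin K with (I.subRounds best T n i).Nonempty,
    (D : ℝ) ^ 2 * I.distMax best T n i ^ 2 * I.delta ^ 2 / I.gapMin best T n i

variable {Ω : Type*}

/-- `r t n i` is the reward vector that user `n` generates at round `t` if arm `i` is pulled for
this user, `c t n` the preference of user `n` at round `t`: all these vectors are mutually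
independent and have the laws prescribed by the instance. -/
structure IsEnvironment [MeasurableSpace Ω] (I : Bandit N K D) (P : Measure Ω)
    (r : ℕ → Fin N → Fin K → Ω → (Fin D → ℝ)) (c : ℕ → Fin N → Ω → (Fin D → ℝ)) : Prop where
  measurable_reward : ∀ t n i, Measurable (r t n i)
  measurable_pref : ∀ t n, Measurable (c t n)
  law_reward : ∀ t n i, P.map (r t n i) = I.rewardLaw i
  law_pref : ∀ t n, P.map (c t n) = I.prefLaw n
  indep : iIndepFun
    (fun k : (ℕ × Fin N × Fin K) ⊕ (ℕ × Fin N) =>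
      Sum.elim (fun p => r p.1 p.2.1 p.2.2) (fun p => c p.1 p.2) k) P

/-- The σ-algebra generated by all rewards and preferences of the rounds in `S`. -/
@[reducible]
def envInfo (r : ℕ → Fin N → Fin K → Ω → (Fin D → ℝ)) (c : ℕ → Fin N → Ω → (Fin D → ℝ))
    (S : Set ℕ) : MeasurableSpace Ω :=
  ⨆ s ∈ S, ⨆ n : Fin N,
    (MeasurableSpace.comap (c s n) inferInstance ⊔
      ⨆ i : Fin K, MeasurableSpace.comap (r s n i) inferInstance)

/-- `N_{i,t}`: the number of pulls of arm `i`, over all users, in the rounds before `t`. -/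
def pullCount (a : ℕ → Fin N → Ω → Fin K) (t : ℕ) (i : Fin K) (ω : Ω) : ℕ :=
  ∑ s ∈ Finset.Ico 1 t, ∑ n : Fin N, if a s n ω = i then 1 else 0

/-- The empirical mean reward of arm `i` before round `t`; it is `0` before the first pull. -/
def rewardEst (r : ℕ → Fin N → Fin K → Ω → (Fin D → ℝ)) (a : ℕ → Fin N → Ω → Fin K)
    (t : ℕ) (i : Fin K) (ω : Ω) : Fin D → ℝ :=
  (pullCount a t i ω : ℝ)⁻¹ •
    ∑ s ∈ Finset.Ico 1 t, ∑ n : Fin N, if a s n ω = i then r s n (a s n ω) ω else 0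

/-- The empirical mean preference of user `n` before round `t`; it is `0` at `t = 1`. -/
def prefEst (c : ℕ → Fin N → Ω → (Fin D → ℝ)) (t : ℕ) (n : Fin N) (ω : Ω) : Fin D → ℝ :=
  ((t : ℝ) - 1)⁻¹ • ∑ s ∈ Finset.Ico 1 t, c s n ω

/-- The Hoeffding bonus `√(log (t/α) / max {1, N_{i,t}})`. -/
def bonus (α : ℝ) (a : ℕ → Fin N → Ω → Fin K) (t : ℕ) (i : Fin K) (ω : Ω) : ℝ :=
  √(Real.log ((t : ℝ) / α) / max 1 (pullCount a t i ω : ℝ))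

/-- The index maximized by the algorithm. -/
def ucbIndex (α : ℝ) (r : ℕ → Fin N → Fin K → Ω → (Fin D → ℝ)) (c : ℕ → Fin N → Ω → (Fin D → ℝ))
    (a : ℕ → Fin N → Ω → Fin K) (t : ℕ) (n : Fin N) (i : Fin K) (ω : Ω) : ℝ :=
  prefEst c t n ω ⬝ᵥ (rewardEst r a t i ω + fun _ => bonus α a t i ω)

/-- `a` is a run of PRUCB-UP with parameter `α`: at every round `t ≥ 1`, for every user, the arm is
a maximizer of the index over the offered arms. Ties are broken in any way that looks only at
earlier rounds and at an internal source of randomness `𝒰` independent of the environment. -/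
structure IsPRUCBUP (𝒰 : MeasurableSpace Ω) [mΩ : MeasurableSpace Ω] (I : Bandit N K D)
    (P : Measure Ω) (α : ℝ)
    (r : ℕ → Fin N → Fin K → Ω → (Fin D → ℝ)) (c : ℕ → Fin N → Ω → (Fin D → ℝ))
    (a : ℕ → Fin N → Ω → Fin K) : Prop where
  seed_le : 𝒰 ≤ mΩ
  seed_indep : Indep 𝒰 (envInfo r c Set.univ) P
  adapted : ∀ t n, 1 ≤ t → Measurable[𝒰 ⊔ envInfo r c (Set.Ico 1 t)] (a t n)
  mem : ∀ t n ω, 1 ≤ t → a t n ω ∈ I.armSet t n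
  isMax : ∀ t n ω, 1 ≤ t →
    ∀ j ∈ I.armSet t n, ucbIndex α r c a t n j ω ≤ ucbIndex α r c a t n (a t n ω) ω

/-- The regret over `T` rounds and all users. -/
def regret (I : Bandit N K D) (best : ℕ → Fin N → Fin K) (a : ℕ → Fin N → Ω → Fin K) (T : ℕ)
    (ω : Ω) : ℝ :=
  ∑ t ∈ Finset.Icc 1 T, ∑ n : Fin N, I.gap best t n (a t n ω)

/-- The pull for user `n` at round `t` is attributed to an imprecise preference estimate: the
estimated preference preserves at most half of the gap between the optimal and the pulled arm. -/
def PrefError (I : Bandit N K D) (best : ℕ → Fin N → Fin K) (c : ℕ → Fin N → Ω → (Fin D → ℝ))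
    (a : ℕ → Fin N → Ω → Fin K) (t : ℕ) (n : Fin N) (ω : Ω) : Prop :=
  prefEst c t n ω ⬝ᵥ (I.meanReward (best t n) - I.meanReward (a t n ω))
    ≤ I.gap best t n (a t n ω) / 2

open Classical in
/-- The regret caused by imprecise preference estimates. -/
def regretPref (I : Bandit N K D) (best : ℕ → Fin N → Fin K) (c : ℕ → Fin N → Ω → (Fin D → ℝ))
    (a : ℕ → Fin N → Ω → Fin K) (T : ℕ) (ω : Ω) : ℝ :=
  ∑ t ∈ Finset.Icc 1 T, ∑ n : Fin N,
    if PrefError I best c a t n ω then I.gap best t n (a t n ω) else 0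

open Classical in
/-- The regret caused by imprecise reward estimates (the preference estimate being precise). -/
def regretReward (I : Bandit N K D) (best : ℕ → Fin N → Fin K) (c : ℕ → Fin N → Ω → (Fin D → ℝ))
    (a : ℕ → Fin N → Ω → Fin K) (T : ℕ) (ω : Ω) : ℝ :=
  ∑ t ∈ Finset.Icc 1 T, ∑ n : Fin N,
    if PrefError I best c a t n ω then 0 else I.gap best t n (a t n ω)

end PAMO

end

/-! Sort the regret by user `n` and suboptimal arm `i`.

A pull with a preference error forces the estimate of `n` to deviate by half the gap `η` in a fixed
direction with coordinates at most `‖Δ‖₂`, so by Hoeffding it has probability at most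
`2 exp (-t η² / (16 δ² ‖Δ‖₂²))`. Summing gap times probability over `t` costs no logarithm although
the gap varies with `t`: up to the time `A / η↓²` the summand is at most of order `√(A / t)`, and
afterwards it decays geometrically.

A pull without a preference error finds `i` either undersampled, `N_i η² ≤ 128 δ² log (T / α)`, or
oversampled. The `k`-th undersampled pull has gap of order `√(B / k)`, which sums to `B / η↓`. An
oversampled pull requires the rewards of `i` or of the best arm to deviate in the direction of the
normalized preference estimate. Rewards are independent of preferences, so this direction may be
frozen by conditioning on all preferences, and the exponential supermartingale of the sampled
rewards bounds the deviation for each value of the pull count. The bonus of the best arm leaves a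
slack `η / 4`, which makes the union over its pull counts a geometric series instead of a factor
`t`. The resulting probability, of order `δ² / η² · t⁻²`, is summable. -/

namespace PAMO

section GapSums

open scoped Finset

theorem sum_exp_neg_mul_le {x : ℝ} (hx : 0 < x) (M : ℕ) :
    ∑ m ∈ Finset.Icc 1 M, Real.exp (-(m * x)) ≤ 1 / x := by
  have hlt : Real.exp (-x) < 1 := by simpa using hx
  calc ∑ m ∈ Finset.Icc 1 M, Real.exp (-(m * x))
      = ∑ m ∈ Finset.Ico 1 (M + 1), Real.exp (-x) ^ m := by
        refine Finset.sum_congr rfl fun m _ => ?_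
        rw [← Real.exp_nat_mul, mul_neg]
    _ ≤ Real.exp (-x) ^ 1 / (1 - Real.exp (-x)) :=
        geom_sum_Ico_le_of_lt_one (Real.exp_pos _).le hlt
    _ ≤ 1 / x := by
        have hmul : Real.exp (-x) * Real.exp x = 1 := by rw [← Real.exp_add]; simp
        rw [pow_one, div_le_div_iff₀ (sub_pos.2 hlt) hx]
        nlinarith [mul_le_mul_of_nonneg_left (Real.add_one_le_exp x) (Real.exp_pos (-x)).le]

section Rank

variable {ι : Type*} [LinearOrder ι] {x : ι → ℝ} {F : Finset ι} {B y : ℝ}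

theorem sum_le_two_mul_sqrt_of_rank_mul_sq_le
    (hF : ∀ t ∈ F, (#{s ∈ F | s ≤ t} : ℝ) * x t ^ 2 ≤ B) :
    ∑ t ∈ F, x t ≤ 2 * (√B * √(#F : ℝ)) := by
  induction F using Finset.induction_on_max with
  | empty => simp
  | insert a s ha ih =>
    have hnot : a ∉ s := fun h => lt_irrefl _ (ha a h)
    have hsum : ∑ t ∈ s, x t ≤ 2 * (√B * √(#s : ℝ)) := ih fun t ht => by
      have := hF t (Finset.mem_insert_of_mem ht)
      rwa [Finset.filter_insert, if_neg (not_le.2 (ha t ht))] at this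
    have hlast : ((#s : ℝ) + 1) * x a ^ 2 ≤ B := by
      have := hF a (Finset.mem_insert_self a s)
      rwa [Finset.filter_true_of_mem fun t ht =>
        (Finset.mem_insert.1 ht).elim le_of_eq fun h => (ha t h).le,
        Finset.card_insert_of_notMem hnot, Nat.cast_succ] at this
    rw [Finset.sum_insert hnot, Finset.card_insert_of_notMem hnot, Nat.cast_succ]
    set p := √(#s : ℝ)
    set q := √((#s : ℝ) + 1)
    have hp : p ^ 2 = #s := Real.sq_sqrt (by positivity)
    have hq : q ^ 2 = #s + 1 := Real.sq_sqrt (by positivity)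
    have hq_pos : 0 < q := Real.sqrt_pos.2 (by positivity)
    have hpq : p ≤ q := Real.sqrt_le_sqrt (by linarith)
    have hxa : q * x a ≤ √B := Real.le_sqrt_of_sq_le (by rwa [mul_pow, hq])
    have hstep : 1 ≤ 2 * q * (q - p) := by nlinarith [Real.sqrt_nonneg (#s : ℝ)]
    have : x a ≤ 2 * √B * (q - p) :=
      le_of_mul_le_mul_left (by nlinarith [Real.sqrt_nonneg B]) hq_pos
    linarith

theorem sum_le_of_rank_mul_sq_le (hB : 0 ≤ B) (hy : 0 < y) (hxy : ∀ t ∈ F, y ≤ x t)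
    (hF : ∀ t ∈ F, (#{s ∈ F | s ≤ t} : ℝ) * x t ^ 2 ≤ B) :
    ∑ t ∈ F, x t ≤ 2 * (B / y) := by
  rcases F.eq_empty_or_nonempty with rfl | hne
  · simp only [Finset.sum_empty]; positivity
  have hcard : (#F : ℝ) * y ^ 2 ≤ B := by
    have hmax := F.max'_mem hne
    have := hF _ hmax
    rw [Finset.filter_true_of_mem fun t ht => F.le_max' t ht] at this
    refine le_trans ?_ this
    gcongr
    exact hxy _ hmax
  calc ∑ t ∈ F, x t ≤ 2 * (√B * √(#F : ℝ)) := sum_le_two_mul_sqrt_of_rank_mul_sq_le hF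
    _ ≤ 2 * (√B * √(B / y ^ 2)) := by
        gcongr
        rwa [le_div_iff₀ (by positivity)]
    _ = 2 * (B / y) := by
        rw [Real.sqrt_div hB, Real.sqrt_sq hy.le, mul_div_assoc', Real.mul_self_sqrt hB]

end Rank

section ExpSum

variable {A y : ℝ}

theorem mul_sq_mul_exp_neg_le (hA : 0 < A) (k x : ℝ) :
    k * (x * Real.exp (-(k * x ^ 2 / A))) ^ 2 ≤ A := by
  set s := k * x ^ 2 / A with hs
  have hk : k * x ^ 2 = s * A := by rw [hs]; field_simp
  have hexp : s * Real.exp (-s) ^ 2 ≤ 1 := by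
    rw [← Real.exp_nat_mul, Nat.cast_ofNat, mul_neg, Real.exp_neg, ← div_eq_mul_inv,
      div_le_one (Real.exp_pos _)]
    rcases le_total s 0 with h | h
    · exact h.trans (Real.exp_pos _).le
    · linarith [Real.add_one_le_exp (2 * s)]
  calc k * (x * Real.exp (-s)) ^ 2 = k * x ^ 2 * Real.exp (-s) ^ 2 := by ring
    _ = A * (s * Real.exp (-s) ^ 2) := by rw [hk]; ring
    _ ≤ A := mul_le_of_le_one_right hA.le hexp

theorem mul_exp_neg_mul_sq_le_of_le {k x : ℝ} (hA : 0 < A) (hy : 0 < y) (hxy : y ≤ x)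
    (hk : A ≤ k * y ^ 2) :
    x * Real.exp (-(k * x ^ 2 / A)) ≤ y * Real.exp (-(k * (y ^ 2 / A))) := by
  have hu : 1 ≤ x / y := (one_le_div hy).2 hxy
  have hratio : x / y ≤ Real.exp ((x / y) ^ 2 - 1) := by
    nlinarith [Real.add_one_le_exp ((x / y) ^ 2 - 1)]
  have hs : 1 ≤ k * y ^ 2 / A := (one_le_div hA).2 hk
  have hexponent : k * x ^ 2 / A = k * y ^ 2 / A * (x / y) ^ 2 := by field_simp
  calc x * Real.exp (-(k * x ^ 2 / A))
      = y * (x / y * Real.exp (-(k * x ^ 2 / A))) := by field_simp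
    _ ≤ y * (Real.exp ((x / y) ^ 2 - 1) * Real.exp (-(k * x ^ 2 / A))) := by gcongr
    _ ≤ y * Real.exp (-(k * (y ^ 2 / A))) := by
        rw [← Real.exp_add, hexponent, ← mul_div_assoc]
        gcongr
        nlinarith [mul_nonneg (sub_nonneg.2 hs) (sub_nonneg.2 (one_le_pow₀ hu (n := 2)))]

theorem sum_mul_exp_neg_mul_sq_le_of_mul_sq_le (hA : 0 < A) (hy : 0 < y) {S : Finset ℕ}
    (hS : ∀ k ∈ S, 1 ≤ k ∧ k * y ^ 2 ≤ A) (x : ℕ → ℝ) :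
    ∑ k ∈ S, x k * Real.exp (-(k * x k ^ 2 / A)) ≤ 2 * (A / y) := by
  have hrank (k : ℕ) : (#{s ∈ S | s ≤ k} : ℝ) ≤ k := by
    refine Nat.cast_le.2 ((Finset.card_le_card fun s hs => ?_).trans_eq (Nat.card_Icc 1 k))
    have := Finset.mem_filter.1 hs
    exact Finset.mem_Icc.2 ⟨(hS s this.1).1, this.2⟩
  have hcard : (#S : ℝ) ≤ A / y ^ 2 := by
    have hsub : S ⊆ Finset.Icc 1 ⌊A / y ^ 2⌋₊ := fun k hk => Finset.mem_Icc.2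
      ⟨(hS k hk).1, Nat.le_floor ((le_div_iff₀ (by positivity)).2 (hS k hk).2)⟩
    calc (#S : ℝ) ≤ (⌊A / y ^ 2⌋₊ : ℝ) := by
          exact_mod_cast (Finset.card_le_card hsub).trans_eq (Nat.card_Icc 1 _)
      _ ≤ A / y ^ 2 := Nat.floor_le (by positivity)
  calc ∑ k ∈ S, x k * Real.exp (-(k * x k ^ 2 / A)) ≤ 2 * (√A * √(#S : ℝ)) :=
        sum_le_two_mul_sqrt_of_rank_mul_sq_le fun k _ =>
          (mul_le_mul_of_nonneg_right (hrank k) (sq_nonneg _)).trans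
            (mul_sq_mul_exp_neg_le hA k (x k))
    _ ≤ 2 * (√A * √(A / y ^ 2)) := by gcongr
    _ = 2 * (A / y) := by
        rw [Real.sqrt_div hA.le, Real.sqrt_sq hy.le, mul_div_assoc', Real.mul_self_sqrt hA.le]

theorem sum_mul_exp_neg_mul_sq_le_of_le_mul_sq (hA : 0 < A) (hy : 0 < y) {n : ℕ} {S : Finset ℕ}
    (hS : S ⊆ Finset.Icc 1 n) (hSA : ∀ k ∈ S, A ≤ k * y ^ 2) {x : ℕ → ℝ} (hx : ∀ k ∈ S, y ≤ x k) :
    ∑ k ∈ S, x k * Real.exp (-(k * x k ^ 2 / A)) ≤ A / y :=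
  calc ∑ k ∈ S, x k * Real.exp (-(k * x k ^ 2 / A))
      ≤ ∑ k ∈ S, y * Real.exp (-(k * (y ^ 2 / A))) :=
        Finset.sum_le_sum fun k hk => mul_exp_neg_mul_sq_le_of_le hA hy (hx k hk) (hSA k hk)
    _ ≤ ∑ k ∈ Finset.Icc 1 n, y * Real.exp (-(k * (y ^ 2 / A))) :=
        Finset.sum_le_sum_of_subset_of_nonneg hS fun _ _ _ => by positivity
    _ ≤ y * (1 / (y ^ 2 / A)) := by
        rw [← Finset.mul_sum]
        gcongr
        exact sum_exp_neg_mul_le (by positivity) n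
    _ = A / y := by field_simp

theorem sum_mul_exp_neg_mul_sq_le (hA : 0 < A) (hy : 0 < y) {n : ℕ} {S : Finset ℕ}
    (hS : S ⊆ Finset.Icc 1 n) {x : ℕ → ℝ} (hx : ∀ k ∈ S, y ≤ x k) :
    ∑ k ∈ S, x k * Real.exp (-(k * x k ^ 2 / A)) ≤ 3 * (A / y) := by
  have hearly : ∑ k ∈ S with (k : ℕ) * y ^ 2 ≤ A, x k * Real.exp (-(k * x k ^ 2 / A))
      ≤ 2 * (A / y) :=
    sum_mul_exp_neg_mul_sq_le_of_mul_sq_le hA hy (fun k hk =>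
      ⟨(Finset.mem_Icc.1 (hS (Finset.mem_filter.1 hk).1)).1, (Finset.mem_filter.1 hk).2⟩) x
  have hlate : ∑ k ∈ S with ¬ (k : ℕ) * y ^ 2 ≤ A, x k * Real.exp (-(k * x k ^ 2 / A))
      ≤ A / y :=
    sum_mul_exp_neg_mul_sq_le_of_le_mul_sq hA hy ((Finset.filter_subset _ S).trans hS)
      (fun k hk => (not_le.1 (Finset.mem_filter.1 hk).2).le)
      fun k hk => hx k (Finset.mem_filter.1 hk).1
  rw [← Finset.sum_filter_add_sum_filter_not S fun k : ℕ => k * y ^ 2 ≤ A]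
  linarith

end ExpSum

end GapSums

section Concentration

variable {Ω : Type*}

section Independence

variable {m₀ m₁ m₂ H : MeasurableSpace Ω} [mΩ : MeasurableSpace Ω] {P : Measure Ω}

theorem indep_sup_right_of_indep_sup (h₀ : m₀ ≤ mΩ) (h₁ : m₁ ≤ mΩ) (h₂ : m₂ ≤ mΩ)
    [IsZeroOrProbabilityMeasure P] (h : Indep m₀ (m₁ ⊔ m₂) P) (h' : Indep m₁ m₂ P) :
    Indep m₁ (m₀ ⊔ m₂) P := by
  let S : Set (Set Ω) := Set.image2 (· ∩ ·) {s | MeasurableSet[m₀] s} {s | MeasurableSet[m₂] s}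
  have hS : IsPiSystem S := by
    rintro _ ⟨s, hs, t, ht, rfl⟩ _ ⟨s', hs', t', ht', rfl⟩ -
    exact ⟨s ∩ s', hs.inter hs', t ∩ t', ht.inter ht', Set.inter_inter_inter_comm _ _ _ _⟩
  have hgen : m₀ ⊔ m₂ = MeasurableSpace.generateFrom S := by
    refine le_antisymm (sup_le (fun s hs => ?_) fun s hs => ?_)
      (MeasurableSpace.generateFrom_le ?_)
    · exact MeasurableSpace.measurableSet_generateFrom ⟨s, hs, Set.univ, .univ, Set.inter_univ s⟩
    · exact MeasurableSpace.measurableSet_generateFrom ⟨Set.univ, .univ, s, hs, Set.univ_inter s⟩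
    · rintro _ ⟨s, hs, t, ht, rfl⟩
      exact MeasurableSet.inter ((le_sup_left : m₀ ≤ m₀ ⊔ m₂) s hs)
        ((le_sup_right : m₂ ≤ m₀ ⊔ m₂) t ht)
  refine IndepSets.indep h₁ (sup_le h₀ h₂) (@MeasurableSpace.isPiSystem_measurableSet Ω m₁) hS
    (@MeasurableSpace.generateFrom_measurableSet Ω m₁).symm hgen ?_
  rw [IndepSets_iff]
  rintro t _ ht ⟨s, hs, s', hs', rfl⟩
  rw [Indep_iff] at h h'
  have htm : MeasurableSet[m₁ ⊔ m₂] t := (le_sup_left : m₁ ≤ m₁ ⊔ m₂) t ht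
  have hsm : MeasurableSet[m₁ ⊔ m₂] s' := (le_sup_right : m₂ ≤ m₁ ⊔ m₂) s' hs'
  change P (t ∩ (s ∩ s')) = P t * P (s ∩ s')
  rw [Set.inter_left_comm, h s (t ∩ s') hs (htm.inter hsm), h' t s' ht hs', h s s' hs hsm]
  ring

theorem indep_comap_sup_iSup_ne {κ E : Type*} [MeasurableSpace E]
    [IsZeroOrProbabilityMeasure P] {X : κ → Ω → E} (hX : ∀ k, Measurable (X k))
    (hi : iIndepFun X P) (h₀ : m₀ ≤ mΩ)
    (h : Indep m₀ (⨆ k, MeasurableSpace.comap (X k) inferInstance) P) (k : κ) :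
    Indep (MeasurableSpace.comap (X k) inferInstance)
      (m₀ ⊔ ⨆ j ≠ k, MeasurableSpace.comap (X j) inferInstance) P := by
  have hle (j : κ) : MeasurableSpace.comap (X j) inferInstance ≤ mΩ := (hX j).comap_le
  refine indep_sup_right_of_indep_sup h₀ (hle k) (iSup₂_le fun j _ => hle j) ?_ ?_
  · exact indep_of_indep_of_le_right h (sup_le (le_iSup (fun j => MeasurableSpace.comap (X j) _) k)
      (iSup₂_le fun j _ => le_iSup (fun j => MeasurableSpace.comap (X j) _) j))
  · rw [iIndepFun_iff_iIndep] at hi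
    simpa using indep_iSup_of_disjoint hle hi (S := {k}) (T := {k}ᶜ) disjoint_compl_right

variable {V E : Type*} [MeasurableSpace V] [MeasurableSpace E]

theorem lintegral_mul_le_of_indep [IsFiniteMeasure P] (hH : H ≤ mΩ) {X : Ω → E}
    (hX : Measurable X) (hind : Indep (MeasurableSpace.comap X inferInstance) H P)
    {Y : Ω → ENNReal} (hY : Measurable[H] Y) {v : Ω → V} (hv : Measurable[H] v)
    {g : V → E → ENNReal} (hg : Measurable (Function.uncurry g))
    (hg_le : ∀ w, ∫⁻ x, g w x ∂(P.map X) ≤ 1) :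
    ∫⁻ ω, Y ω * g (v ω) (X ω) ∂P ≤ ∫⁻ ω, Y ω ∂P := by
  have hYvH : Measurable[H] fun ω => (Y ω, v ω) := hY.prodMk hv
  have hYv : Measurable fun ω => (Y ω, v ω) := hYvH.mono hH le_rfl
  have hindep : IndepFun (fun ω => (Y ω, v ω)) X P :=
    (IndepFun_iff_Indep _ _ _).2 (indep_of_indep_of_le_left hind.symm hYvH.comap_le)
  have hmap := (indepFun_iff_map_prod_eq_prod_map_map hYv.aemeasurable hX.aemeasurable).1 hindep
  have hmul : Measurable fun q : (ENNReal × V) × E => q.1.1 * g q.1.2 q.2 := by fun_prop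
  calc ∫⁻ ω, Y ω * g (v ω) (X ω) ∂P
      = ∫⁻ q, q.1.1 * g q.1.2 q.2 ∂(P.map fun ω => ((Y ω, v ω), X ω)) := by
        rw [lintegral_map hmul (hYv.prodMk hX)]
    _ = ∫⁻ p, ∫⁻ x, p.1 * g p.2 x ∂(P.map X) ∂(P.map fun ω => (Y ω, v ω)) := by
        rw [hmap, lintegral_prod _ hmul.aemeasurable]
    _ ≤ ∫⁻ p, p.1 ∂(P.map fun ω => (Y ω, v ω)) := by
        refine lintegral_mono fun p => ?_
        rw [lintegral_const_mul _ (by fun_prop)]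
        exact mul_le_of_le_one_right' (hg_le p.2)
    _ = ∫⁻ ω, Y ω ∂P := lintegral_map measurable_fst hYv

/-- Taken in the order of the times `τ p`, the factors multiply to a supermartingale. -/
theorem lintegral_prod_le_one_of_indep {ι β : Type*} [LinearOrder β] [IsProbabilityMeasure P]
    {A : Finset ι} (τ : ι → β) {H : ι → MeasurableSpace Ω} (hH : ∀ p, H p ≤ mΩ)
    {X : ι → Ω → E} (hX : ∀ p, Measurable (X p))
    (hind : ∀ p, Indep (MeasurableSpace.comap (X p) inferInstance) (H p) P)
    {v : ι → Ω → V} (hv : ∀ p ∈ A, Measurable[H p] (v p))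
    (hpast : ∀ p ∈ A, ∀ q ∈ A, q ≠ p → τ q ≤ τ p → Measurable[H p] fun ω => (v q ω, X q ω))
    {g : V → E → ENNReal} (hg : Measurable (Function.uncurry g))
    (hg_le : ∀ p w, ∫⁻ x, g w x ∂(P.map (X p)) ≤ 1) :
    ∫⁻ ω, ∏ p ∈ A, g (v p ω) (X p ω) ∂P ≤ 1 := by
  classical
  induction A using Finset.induction_on_max_value τ with
  | empty => simp
  | insert p A hp hmax ih =>
    have hprod : Measurable[H p] fun ω => ∏ q ∈ A, g (v q ω) (X q ω) :=
      Finset.measurable_fun_prod A fun q hq => hg.comp (hpast p (Finset.mem_insert_self p A) q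
        (Finset.mem_insert_of_mem hq) (fun h => hp (h ▸ hq)) (hmax q hq))
    calc ∫⁻ ω, ∏ q ∈ insert p A, g (v q ω) (X q ω) ∂P
        = ∫⁻ ω, (∏ q ∈ A, g (v q ω) (X q ω)) * g (v p ω) (X p ω) ∂P := by
          simp only [Finset.prod_insert hp, mul_comm]
      _ ≤ ∫⁻ ω, ∏ q ∈ A, g (v q ω) (X q ω) ∂P :=
          lintegral_mul_le_of_indep (hH p) (hX p) (hind p) hprod
            (hv p (Finset.mem_insert_self p A)) hg (hg_le p)
      _ ≤ 1 := ih (fun q hq => hv q (Finset.mem_insert_of_mem hq)) fun q hq q' hq' =>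
          hpast q (Finset.mem_insert_of_mem hq) q' (Finset.mem_insert_of_mem hq')

theorem measureReal_le_exp_neg_of_lintegral_exp_le_one [IsFiniteMeasure P] {S : Ω → ℝ}
    (hS : Measurable S) (hle : ∫⁻ ω, ENNReal.ofReal (Real.exp (S ω)) ∂P ≤ 1) (b : ℝ) :
    P.real {ω | b ≤ S ω} ≤ Real.exp (-b) := by
  have hmarkov : ENNReal.ofReal (Real.exp b) * P {ω | b ≤ S ω} ≤ 1 := by
    refine le_trans ?_ ((mul_meas_ge_le_lintegral₀ (μ := P)
      (by fun_prop : Measurable fun ω => ENNReal.ofReal (Real.exp (S ω))).aemeasurable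
      (ENNReal.ofReal (Real.exp b))).trans hle)
    gcongr with ω
    exact fun h => ENNReal.ofReal_le_ofReal (Real.exp_le_exp.2 h)
  have := ENNReal.toReal_mono ENNReal.one_ne_top hmarkov
  rw [ENNReal.toReal_mul, ENNReal.toReal_ofReal (Real.exp_nonneg b), ENNReal.toReal_one] at this
  rwa [Real.exp_neg, ← one_div, le_div_iff₀ (Real.exp_pos b), mul_comm]

end Independence

section CubeHoeffding

variable {ι : Type*} {ρ : Measure (ι → ℝ)}

theorem integrable_apply_of_abs_le [IsFiniteMeasure ρ] {B : ℝ}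
    (h : ∀ᵐ x ∂ρ, ∀ d, |x d| ≤ B) (d : ι) : Integrable (fun x => x d) ρ :=
  .of_bound (measurable_pi_apply d).aestronglyMeasurable B (h.mono fun _ hx => hx d)

variable [Fintype ι]

theorem abs_dotProduct_le (v x : ι → ℝ) {B : ℝ} (hx : ∀ d, |x d| ≤ B) :
    |v ⬝ᵥ x| ≤ (∑ d, |v d|) * B := by
  rw [dotProduct, Finset.sum_mul]
  refine (Finset.abs_sum_le_sum_abs _ _).trans (Finset.sum_le_sum fun d _ => ?_)
  rw [abs_mul]
  exact mul_le_mul_of_nonneg_left (hx d) (abs_nonneg _)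

theorem integral_dotProduct (h : ∀ d, Integrable (fun x => x d) ρ) (v : ι → ℝ) :
    ∫ x, v ⬝ᵥ x ∂ρ = v ⬝ᵥ fun d => ∫ x, x d ∂ρ := by
  simp only [dotProduct, integral_finsetSum _ fun d _ => (h d).const_mul _, integral_const_mul]

theorem dotProduct_mem_Icc_of_mem_Icc (v : ι → ℝ) {x : ι → ℝ}
    (hx : ∀ d, x d ∈ Set.Icc (0 : ℝ) 1) :
    v ⬝ᵥ x ∈ Set.Icc (∑ d, min (v d) 0) (∑ d, max (v d) 0) := by
  refine ⟨Finset.sum_le_sum fun d _ => ?_, Finset.sum_le_sum fun d _ => ?_⟩ <;>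
    obtain ⟨h0, h1⟩ := hx d <;> rcases le_total (v d) 0 with hv | hv
  · rw [min_eq_left hv]; nlinarith
  · rw [min_eq_right hv]; positivity
  · rw [max_eq_right hv]; nlinarith
  · rw [max_eq_left hv]; nlinarith

theorem hasSubgaussianMGF_dotProduct_of_mem_Icc [IsProbabilityMeasure ρ]
    (h : ∀ᵐ x ∂ρ, ∀ d, x d ∈ Set.Icc (0 : ℝ) 1) (v : ι → ℝ) :
    HasSubgaussianMGF (fun x => v ⬝ᵥ (x - fun d => ∫ x, x d ∂ρ))
      ((‖∑ d, |v d|‖₊ / 2) ^ 2) ρ := by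
  have hint : ∀ d, Integrable (fun x => x d) ρ := integrable_apply_of_abs_le (B := 1)
    (h.mono fun x hx d => abs_le.2 ⟨by linarith [(hx d).1], (hx d).2⟩)
  have hlen : (∑ d, max (v d) 0) - ∑ d, min (v d) 0 = ∑ d, |v d| := by
    simp only [← Finset.sum_sub_distrib, max_sub_min_eq_abs, zero_sub, abs_neg]
  have hmeas : Measurable fun x : ι → ℝ => v ⬝ᵥ x := by unfold dotProduct; fun_prop
  have := hasSubgaussianMGF_of_mem_Icc hmeas.aemeasurable
    (h.mono fun x hx => dotProduct_mem_Icc_of_mem_Icc v hx)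
  simpa only [hlen, integral_dotProduct hint, ← dotProduct_sub] using this

theorem lintegral_exp_dotProduct_le_one [IsProbabilityMeasure ρ]
    (h : ∀ᵐ x ∂ρ, ∀ d, x d ∈ Set.Icc (0 : ℝ) 1) (v : ι → ℝ) :
    ∫⁻ x, ENNReal.ofReal
      (Real.exp (v ⬝ᵥ (x - fun d => ∫ x, x d ∂ρ) - (∑ d, |v d|) ^ 2 / 8)) ∂ρ ≤ 1 := by
  have hs := hasSubgaussianMGF_dotProduct_of_mem_Icc h v
  have hmgf := hs.mgf_le 1
  have hint := hs.integrable_exp_mul 1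
  have hexponent : (((‖∑ d, |v d|‖₊ / 2) ^ 2 : NNReal) : ℝ) * 1 ^ 2 / 2
      = (∑ d, |v d|) ^ 2 / 8 := by
    push_cast
    rw [div_pow, Real.norm_eq_abs, sq_abs]
    ring
  simp only [mgf, one_mul] at hmgf hint
  rw [hexponent] at hmgf
  simp only [Real.exp_sub]
  rw [← ofReal_integral_eq_lintegral_ofReal (hint.div_const _) (.of_forall fun x => by positivity),
    integral_div, ENNReal.ofReal_le_one, div_le_one (Real.exp_pos _)]
  exact hmgf

end CubeHoeffding

end Concentration

section Gaps

variable {N K D : ℕ}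

section Instance

variable (I : Bandit N K D)

theorem Bandit.meanReward_mem (i : Fin K) (d : Fin D) : I.meanReward i d ∈ Set.Icc (0 : ℝ) 1 := by
  have := I.reward_prob i
  have hmem := I.reward_mem i
  have hint : Integrable (fun x : Fin D → ℝ => x d) (I.rewardLaw i) :=
    integrable_apply_of_abs_le (B := 1)
      (hmem.mono fun x hx d => abs_le.2 ⟨by linarith [(hx d).1], (hx d).2⟩) d
  refine ⟨integral_nonneg_of_ae (hmem.mono fun x hx => (hx d).1), ?_⟩
  simpa [Bandit.meanReward] using
    integral_mono_ae hint (integrable_const 1) (hmem.mono fun x hx => (hx d).2)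

theorem Bandit.abs_meanReward_sub_le_one (i j : Fin K) (d : Fin D) :
    |(I.meanReward j - I.meanReward i) d| ≤ 1 := by
  have hi := I.meanReward_mem i d
  have hj := I.meanReward_mem j d
  rw [Pi.sub_apply, abs_le]
  constructor <;> linarith [hi.1, hi.2, hj.1, hj.2]

theorem Bandit.abs_meanReward_sub_le_norm (i j : Fin K) (d : Fin D) :
    |(I.meanReward j - I.meanReward i) d| ≤
      ‖WithLp.toLp 2 (I.meanReward i - I.meanReward j)‖ := by
  rw [← neg_sub, Pi.neg_apply, abs_neg]
  exact PiLp.norm_apply_le (WithLp.toLp 2 (I.meanReward i - I.meanReward j)) d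

theorem Bandit.integrable_pref_apply (n : Fin N) (d : Fin D) :
    Integrable (fun x => x d) (I.prefLaw n) := by
  have := I.pref_prob n
  exact integrable_apply_of_abs_le ((I.pref_norm n).mono fun x hx d =>
    (Finset.single_le_sum (f := fun d => |x d|) (fun _ _ => abs_nonneg _)
      (Finset.mem_univ d)).trans hx) d

theorem Bandit.meanPref_nonneg (n : Fin N) (d : Fin D) : 0 ≤ I.meanPref n d :=
  integral_nonneg_of_ae ((I.pref_nonneg n).mono fun _ hx => hx d)

theorem Bandit.sum_meanPref_le (n : Fin N) : ∑ d, I.meanPref n d ≤ I.delta := by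
  have := I.pref_prob n
  simp only [Bandit.meanPref]
  rw [← integral_finsetSum _ fun d _ => I.integrable_pref_apply n d]
  simpa using integral_mono_ae (integrable_finsetSum _ fun d _ => I.integrable_pref_apply n d)
    (integrable_const I.delta)
    ((I.pref_norm n).mono fun x hx => (Finset.sum_le_sum fun d _ => le_abs_self (x d)).trans hx)

theorem Bandit.delta_nonneg (n : Fin N) : 0 ≤ I.delta :=
  (Finset.sum_nonneg fun d _ => I.meanPref_nonneg n d).trans (I.sum_meanPref_le n)

theorem Bandit.meanPref_dotProduct_le (n : Fin N) (x : Fin D → ℝ) {B : ℝ} (hB : 0 ≤ B)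
    (hx : ∀ d, |x d| ≤ B) : I.meanPref n ⬝ᵥ x ≤ I.delta * B := by
  refine (le_abs_self _).trans ((abs_dotProduct_le _ x hx).trans
    (mul_le_mul_of_nonneg_right ?_ hB))
  simpa only [abs_of_nonneg (I.meanPref_nonneg n _)] using I.sum_meanPref_le n

variable {I} {best : ℕ → Fin N → Fin K} {T t : ℕ} {n : Fin N} {i : Fin K}

theorem Bandit.gap_nonneg (hbest : I.IsBestArm t n (best t n)) (hi : i ∈ I.armSet t n) :
    0 ≤ I.gap best t n i := by
  rw [Bandit.gap, dotProduct_sub, sub_nonneg]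
  exact hbest.2 i hi

theorem Bandit.gap_le_delta (best : ℕ → Fin N → Fin K) (t : ℕ) (n : Fin N) (i : Fin K) :
    I.gap best t n i ≤ I.delta :=
  (I.meanPref_dotProduct_le n _ zero_le_one (I.abs_meanReward_sub_le_one i _)).trans_eq (mul_one _)

theorem Bandit.mem_subRounds :
    t ∈ I.subRounds best T n i ↔ (1 ≤ t ∧ t ≤ T) ∧ i ∈ I.armSet t n ∧ 0 < I.gap best t n i := by
  simp [Bandit.subRounds]

theorem Bandit.gapMin_le (ht : t ∈ I.subRounds best T n i) :
    I.gapMin best T n i ≤ I.gap best t n i :=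
  csInf_le ((Finset.finite_toSet _).image _).bddBelow ⟨t, ht, rfl⟩

theorem Bandit.le_gapMax (ht : t ∈ I.subRounds best T n i) :
    I.gap best t n i ≤ I.gapMax best T n i :=
  le_csSup ((Finset.finite_toSet _).image _).bddAbove ⟨t, ht, rfl⟩

theorem Bandit.gapMin_pos (h : (I.subRounds best T n i).Nonempty) : 0 < I.gapMin best T n i := by
  obtain ⟨t, ht, heq⟩ := (Set.Nonempty.image (fun t => I.gap best t n i)
    (Finset.coe_nonempty.2 h)).csInf_mem ((Finset.finite_toSet _).image _)
  rw [Bandit.gapMin, ← heq]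
  exact (Bandit.mem_subRounds.1 ht).2.2

theorem Bandit.gapMax_pos (h : (I.subRounds best T n i).Nonempty) : 0 < I.gapMax best T n i := by
  obtain ⟨t, ht⟩ := h
  exact (Bandit.mem_subRounds.1 ht).2.2.trans_le (Bandit.le_gapMax ht)

theorem Bandit.norm_le_distMax (ht : t ∈ I.subRounds best T n i) {j : Fin K}
    (hj : j ∈ I.armSet t n) :
    ‖WithLp.toLp 2 (I.meanReward i - I.meanReward j)‖ ≤ I.distMax best T n i := by
  refine le_csSup (((Set.finite_range fun j : Fin K =>
    ‖WithLp.toLp 2 (I.meanReward i - I.meanReward j)‖).subset ?_).bddAbove) ⟨t, ht, j, hj, rfl⟩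
  rintro x ⟨_, _, j, _, rfl⟩
  exact ⟨j, rfl⟩

theorem Bandit.abs_meanReward_sub_le_distMax (hbest : I.IsBestArm t n (best t n))
    (ht : t ∈ I.subRounds best T n i) (d : Fin D) :
    |(I.meanReward (best t n) - I.meanReward i) d| ≤ I.distMax best T n i :=
  (I.abs_meanReward_sub_le_norm i _ d).trans (Bandit.norm_le_distMax ht hbest.1)

theorem Bandit.distMax_nonneg (ht : t ∈ I.subRounds best T n i) : 0 ≤ I.distMax best T n i :=
  (norm_nonneg _).trans (Bandit.norm_le_distMax ht (Bandit.mem_subRounds.1 ht).2.1)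

theorem Bandit.gap_le_delta_mul_distMax (hbest : I.IsBestArm t n (best t n))
    (ht : t ∈ I.subRounds best T n i) : I.gap best t n i ≤ I.delta * I.distMax best T n i :=
  I.meanPref_dotProduct_le n _ (Bandit.distMax_nonneg ht)
    (Bandit.abs_meanReward_sub_le_distMax hbest ht)

theorem Bandit.one_le_dim (ht : t ∈ I.subRounds best T n i) : 1 ≤ D := by
  rcases Nat.eq_zero_or_pos D with rfl | h
  · have := (Bandit.mem_subRounds.1 ht).2.2
    simp [Bandit.gap] at this
  · exact h

end Instance

section Preference

variable {Ω : Type*} [MeasurableSpace Ω] {I : Bandit N K D} {P : Measure Ω}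
  {r : ℕ → Fin N → Fin K → Ω → (Fin D → ℝ)} {c : ℕ → Fin N → Ω → (Fin D → ℝ)}

theorem IsEnvironment.ae_pref (hE : IsEnvironment I P r c) (t : ℕ) (n : Fin N) :
    ∀ᵐ ω ∂P, (∀ d, 0 ≤ c t n ω d) ∧ ∑ d, |c t n ω d| ≤ I.delta := by
  refine ae_of_ae_map (p := fun z => (∀ d, 0 ≤ z d) ∧ ∑ d, |z d| ≤ I.delta)
    (hE.measurable_pref t n).aemeasurable ?_
  rw [hE.law_pref]
  exact (I.pref_nonneg n).and (I.pref_norm n)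

theorem IsEnvironment.ae_prefEst (hE : IsEnvironment I P r c) (t : ℕ) (n : Fin N) :
    ∀ᵐ ω ∂P, (∀ d, 0 ≤ prefEst c t n ω d) ∧ ∑ d, prefEst c t n ω d ≤ I.delta := by
  filter_upwards [ae_all_iff.2 fun s => hE.ae_pref s n] with ω hω
  simp only [prefEst, Pi.smul_apply, Finset.sum_apply, smul_eq_mul]
  rcases Nat.lt_or_ge t 2 with ht | ht
  · simpa [Finset.Ico_eq_empty (by omega : ¬ 1 < t)] using I.delta_nonneg n
  have hcard : ((t - 1 : ℕ) : ℝ) = (t : ℝ) - 1 := Nat.cast_pred (by omega)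
  have ht_pos : (0 : ℝ) < (t : ℝ) - 1 := by rw [← hcard]; exact_mod_cast (by omega : 0 < t - 1)
  refine ⟨fun d => mul_nonneg (inv_nonneg.2 ht_pos.le)
    (Finset.sum_nonneg fun s _ => (hω s).1 d), ?_⟩
  rw [← Finset.mul_sum, Finset.sum_comm, inv_mul_le_iff₀ ht_pos]
  calc ∑ s ∈ Finset.Ico 1 t, ∑ d, c s n ω d ≤ ∑ _s ∈ Finset.Ico 1 t, I.delta :=
        Finset.sum_le_sum fun s _ =>
          (Finset.sum_le_sum fun d _ => le_abs_self _).trans (hω s).2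
    _ = (t - 1) * I.delta := by rw [Finset.sum_const, Nat.card_Ico, nsmul_eq_mul, hcard]

theorem IsEnvironment.integral_pref_dotProduct (hE : IsEnvironment I P r c) (t : ℕ) (n : Fin N)
    (x : Fin D → ℝ) : ∫ ω, c t n ω ⬝ᵥ x ∂P = I.meanPref n ⬝ᵥ x := by
  have hdot : Measurable fun z : Fin D → ℝ => z ⬝ᵥ x := by unfold dotProduct; fun_prop
  rw [← integral_map (f := fun z => z ⬝ᵥ x) (hE.measurable_pref t n).aemeasurable
    hdot.aestronglyMeasurable, hE.law_pref]
  simp only [dotProduct_comm _ x, integral_dotProduct (I.integrable_pref_apply n)]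
  rfl

variable [IsProbabilityMeasure P] {x : Fin D → ℝ} {B : ℝ}

theorem IsEnvironment.hasSubgaussianMGF_pref (hE : IsEnvironment I P r c) (n : Fin N)
    (hB : 0 ≤ B) (hx : ∀ d, |x d| ≤ B) (t : ℕ) :
    HasSubgaussianMGF (fun ω => I.meanPref n ⬝ᵥ x - c t n ω ⬝ᵥ x) (‖I.delta * B‖₊ ^ 2) P := by
  have hmem : ∀ᵐ ω ∂P, -(c t n ω ⬝ᵥ x) ∈ Set.Icc (-(I.delta * B)) (I.delta * B) := by
    filter_upwards [hE.ae_pref t n] with ω hω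
    have := abs_le.1 ((abs_dotProduct_le (c t n ω) x hx).trans
      (mul_le_mul_of_nonneg_right hω.2 hB))
    exact ⟨by linarith [this.2], by linarith [this.1]⟩
  have hmeas : Measurable fun ω => -(c t n ω ⬝ᵥ x) := by
    have := hE.measurable_pref t n
    unfold dotProduct
    fun_prop
  have hsub := hasSubgaussianMGF_of_mem_Icc hmeas.aemeasurable hmem
  have hparam : (‖I.delta * B - -(I.delta * B)‖₊ / 2) ^ 2 = ‖I.delta * B‖₊ ^ 2 := by
    rw [sub_neg_eq_add, ← two_mul, nnnorm_mul, Real.nnnorm_ofNat,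
      mul_div_cancel_left₀ _ two_ne_zero]
  rw [integral_neg, hE.integral_pref_dotProduct, hparam] at hsub
  simpa only [sub_neg_eq_add, neg_add_eq_sub] using hsub

theorem IsEnvironment.measure_prefEst_dotProduct_le (hE : IsEnvironment I P r c) (n : Fin N)
    (hB : 0 ≤ B) (hx : ∀ d, |x d| ≤ B) (h0 : 0 ≤ I.meanPref n ⬝ᵥ x) {t : ℕ} (ht : 2 ≤ t) :
    P.real {ω | prefEst c t n ω ⬝ᵥ x ≤ (I.meanPref n ⬝ᵥ x) / 2}
      ≤ Real.exp (-((t - 1) * (I.meanPref n ⬝ᵥ x) ^ 2 / (8 * (I.delta * B) ^ 2))) := by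
  set η := I.meanPref n ⬝ᵥ x
  have hcard : ((t - 1 : ℕ) : ℝ) = (t : ℝ) - 1 := Nat.cast_pred (by omega)
  have ht_pos : (0 : ℝ) < (t : ℝ) - 1 := by rw [← hcard]; exact_mod_cast (by omega : 0 < t - 1)
  have hind : iIndepFun (fun s ω => η - c s n ω ⬝ᵥ x) P := by
    have hdot : Measurable fun z : Fin D → ℝ => η - z ⬝ᵥ x := by unfold dotProduct; fun_prop
    exact (hE.indep.precomp (g := fun s : ℕ => Sum.inr (s, n)) fun s s' h => by simpa using h).comp
      (fun _ z => η - z ⬝ᵥ x) fun _ => hdot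
  have hset : {ω | prefEst c t n ω ⬝ᵥ x ≤ η / 2}
      ⊆ {ω | ((t : ℝ) - 1) * η / 2 ≤ ∑ s ∈ Finset.Ico 1 t, (η - c s n ω ⬝ᵥ x)} := by
    intro ω hω
    simp only [Set.mem_ofPred_eq, prefEst, smul_dotProduct, sum_dotProduct, smul_eq_mul] at hω ⊢
    rw [Finset.sum_sub_distrib, Finset.sum_const, Nat.card_Ico, nsmul_eq_mul, hcard]
    rw [inv_mul_le_iff₀ ht_pos] at hω
    linarith
  refine (measureReal_mono hset).trans ((HasSubgaussianMGF.measure_sum_ge_le_of_iIndepFun hind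
    (fun s _ => hE.hasSubgaussianMGF_pref n hB hx s) (by positivity)).trans
      (Real.exp_le_exp.2 (le_of_eq ?_)))
  rw [Finset.sum_const, Nat.card_Ico, nsmul_eq_mul, NNReal.coe_mul, NNReal.coe_natCast, hcard,
    NNReal.coe_pow, coe_nnnorm, Real.norm_of_nonneg (mul_nonneg (I.delta_nonneg n) hB)]
  field_simp
  ring

theorem IsEnvironment.measure_prefEst_dotProduct_le_two_mul (hE : IsEnvironment I P r c)
    (n : Fin N) (hB : 0 ≤ B) (hx : ∀ d, |x d| ≤ B) (h0 : 0 ≤ I.meanPref n ⬝ᵥ x) {t : ℕ}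
    (ht : 1 ≤ t) :
    P.real {ω | prefEst c t n ω ⬝ᵥ x ≤ (I.meanPref n ⬝ᵥ x) / 2}
      ≤ 2 * Real.exp (-(t * (I.meanPref n ⬝ᵥ x) ^ 2 / (16 * (I.delta * B) ^ 2))) := by
  have hle := I.meanPref_dotProduct_le n x hB hx
  set η := I.meanPref n ⬝ᵥ x
  rcases ht.eq_or_lt with rfl | ht
  · have hexponent : η ^ 2 / (16 * (I.delta * B) ^ 2) ≤ 1 / 16 := by
      rw [mul_comm (16 : ℝ), ← div_div]
      gcongr
      exact div_le_one_of_le₀ (by gcongr) (sq_nonneg _)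
    refine measureReal_le_one.trans ?_
    rw [Nat.cast_one, one_mul]
    linarith [Real.add_one_le_exp (-(η ^ 2 / (16 * (I.delta * B) ^ 2)))]
  · have ht2 : (2 : ℝ) ≤ t := by exact_mod_cast ht
    refine (hE.measure_prefEst_dotProduct_le n hB hx h0 ht).trans ?_
    refine (Real.exp_le_exp.2 (neg_le_neg ?_)).trans
      (le_mul_of_one_le_left (Real.exp_pos _).le one_le_two)
    calc (t : ℝ) * η ^ 2 / (16 * (I.delta * B) ^ 2)
        = t / 2 * η ^ 2 / (8 * (I.delta * B) ^ 2) := by field_simp; ring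
      _ ≤ (t - 1) * η ^ 2 / (8 * (I.delta * B) ^ 2) := by
          gcongr
          linarith

end Preference

end Gaps

section Trajectory

variable {N K D : ℕ} {Ω : Type*}

/-- The family of all reward and preference vectors, rewards indexed on the left by round, user
and arm, preferences on the right by round and user. It makes "all vectors but one" expressible. -/
def envVector (r : ℕ → Fin N → Fin K → Ω → (Fin D → ℝ)) (c : ℕ → Fin N → Ω → (Fin D → ℝ)) :
    (ℕ × Fin N × Fin K) ⊕ (ℕ × Fin N) → Ω → (Fin D → ℝ) :=
  Sum.elim (fun p => r p.1 p.2.1 p.2.2) fun p => c p.1 p.2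

/-- The σ-algebra of the internal randomness `𝒰` and of all environment vectors but the one
at `k`. -/
@[reducible]
def otherInfo (𝒰 : MeasurableSpace Ω) (r : ℕ → Fin N → Fin K → Ω → (Fin D → ℝ))
    (c : ℕ → Fin N → Ω → (Fin D → ℝ)) (k : (ℕ × Fin N × Fin K) ⊕ (ℕ × Fin N)) :
    MeasurableSpace Ω :=
  𝒰 ⊔ ⨆ j ≠ k, MeasurableSpace.comap (envVector r c j) inferInstance

/-- The σ-algebra of all preference vectors, past and future. -/
@[reducible]
def prefInfo (c : ℕ → Fin N → Ω → (Fin D → ℝ)) : MeasurableSpace Ω :=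
  ⨆ t, ⨆ n, MeasurableSpace.comap (c t n) inferInstance

/-- The arms `a` are chosen by a policy that looks only at earlier rounds and at an internal
source of randomness `𝒰` independent of the environment. -/
structure IsNonanticipating (𝒰 : MeasurableSpace Ω) [mΩ : MeasurableSpace Ω] (P : Measure Ω)
    (r : ℕ → Fin N → Fin K → Ω → (Fin D → ℝ)) (c : ℕ → Fin N → Ω → (Fin D → ℝ))
    (a : ℕ → Fin N → Ω → Fin K) : Prop where
  seed_le : 𝒰 ≤ mΩ
  seed_indep : Indep 𝒰 (envInfo r c Set.univ) P
  adapted : ∀ t n, 1 ≤ t → Measurable[𝒰 ⊔ envInfo r c (Set.Ico 1 t)] (a t n)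

/-- The sum of the centred rewards of arm `i`, over all its pulls before round `t`. -/
noncomputable def rewardNoise (I : Bandit N K D) (r : ℕ → Fin N → Fin K → Ω → (Fin D → ℝ))
    (a : ℕ → Fin N → Ω → Fin K) (t : ℕ) (i : Fin K) (ω : Ω) : Fin D → ℝ :=
  ∑ p ∈ Finset.Ico 1 t ×ˢ (Finset.univ : Finset (Fin N)),
    if a p.1 p.2 ω = i then r p.1 p.2 i ω - I.meanReward i else 0

/-- The event that, in the direction `u`, the empirical mean of arm `i` before round `t` exceeds
its mean by at least `y m`, where `m ∈ M` is the number of pulls. It is stated for the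
unnormalized sum, so that `m = 0` needs no convention. -/
def noiseEvent (I : Bandit N K D) (r : ℕ → Fin N → Fin K → Ω → (Fin D → ℝ))
    (a : ℕ → Fin N → Ω → Fin K) (u : Ω → Fin D → ℝ) (t : ℕ) (i : Fin K) (M : Set ℕ) (y : ℕ → ℝ) :
    Set Ω :=
  {ω | pullCount a t i ω ∈ M ∧
    pullCount a t i ω * y (pullCount a t i ω) ≤ u ω ⬝ᵥ rewardNoise I r a t i ω}

section Pulls

variable (a : ℕ → Fin N → Ω → Fin K)

theorem pullCount_eq_sum_product (t : ℕ) (i : Fin K) (ω : Ω) :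
    pullCount a t i ω =
      ∑ p ∈ Finset.Ico 1 t ×ˢ (Finset.univ : Finset (Fin N)), if a p.1 p.2 ω = i then 1 else 0 := by
  rw [Finset.sum_product]; rfl

theorem pullCount_le (t : ℕ) (i : Fin K) (ω : Ω) : pullCount a t i ω ≤ (t - 1) * N := by
  rw [pullCount_eq_sum_product, ← Finset.card_filter]
  simpa using Finset.card_filter_le (Finset.Ico 1 t ×ˢ (Finset.univ : Finset (Fin N))) _

theorem dotProduct_rewardNoise_sub_eq_sum (I : Bandit N K D)
    (r : ℕ → Fin N → Fin K → Ω → (Fin D → ℝ)) (u : Fin D → ℝ) (t : ℕ) (i : Fin K) (ω : Ω) :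
    u ⬝ᵥ rewardNoise I r a t i ω - pullCount a t i ω * ((∑ d, |u d|) ^ 2 / 8) =
      ∑ p ∈ Finset.Ico 1 t ×ˢ (Finset.univ : Finset (Fin N)),
        ((if a p.1 p.2 ω = i then u else 0) ⬝ᵥ (r p.1 p.2 i ω - I.meanReward i)
          - (∑ d, |(if a p.1 p.2 ω = i then u else 0) d|) ^ 2 / 8) := by
  rw [rewardNoise, dotProduct_sum, pullCount_eq_sum_product, Nat.cast_sum, Finset.sum_mul,
    ← Finset.sum_sub_distrib]
  refine Finset.sum_congr rfl fun p _ => ?_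
  split_ifs <;> simp

end Pulls

section Info

variable {𝒰 : MeasurableSpace Ω} {r : ℕ → Fin N → Fin K → Ω → (Fin D → ℝ)}
  {c : ℕ → Fin N → Ω → (Fin D → ℝ)}

theorem comap_le_otherInfo {j k : (ℕ × Fin N × Fin K) ⊕ (ℕ × Fin N)} (h : j ≠ k) :
    MeasurableSpace.comap (envVector r c j) inferInstance ≤ otherInfo 𝒰 r c k :=
  le_sup_of_le_right (le_iSup₂_of_le j h le_rfl)

theorem prefInfo_le_otherInfo (p : ℕ × Fin N × Fin K) :
    prefInfo c ≤ otherInfo 𝒰 r c (Sum.inl p) :=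
  iSup₂_le fun t n => comap_le_otherInfo (r := r) (c := c) (j := Sum.inr (t, n)) (by simp)

theorem history_le_otherInfo {s t : ℕ} (hst : s ≤ t) (n : Fin N) (i : Fin K) :
    𝒰 ⊔ envInfo r c (Set.Ico 1 s) ≤ otherInfo 𝒰 r c (Sum.inl (t, n, i)) := by
  refine sup_le le_sup_left (iSup₂_le fun s' hs' => iSup_le fun n' => sup_le ?_ ?_)
  · exact comap_le_otherInfo (r := r) (c := c) (j := Sum.inr (s', n')) (by simp)
  · refine iSup_le fun i' => comap_le_otherInfo (r := r) (c := c) (j := Sum.inl (s', n', i')) ?_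
    have hne : s' ≠ t := (hs'.2.trans_le hst).ne
    simp [hne]

theorem comap_envVector_le_envInfo (k : (ℕ × Fin N × Fin K) ⊕ (ℕ × Fin N)) :
    MeasurableSpace.comap (envVector r c k) inferInstance ≤ envInfo r c Set.univ := by
  rcases k with ⟨t, n, i⟩ | ⟨t, n⟩ <;> refine le_iSup₂_of_le t (Set.mem_univ t) (le_iSup_of_le n ?_)
  · exact le_sup_of_le_right
      (le_iSup (fun i => MeasurableSpace.comap (r t n i) inferInstance) i)
  · exact le_sup_left

end Info

section Sampling

variable {𝒰 : MeasurableSpace Ω} [mΩ : MeasurableSpace Ω] {I : Bandit N K D}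
  {P : Measure Ω} {r : ℕ → Fin N → Fin K → Ω → (Fin D → ℝ)} {c : ℕ → Fin N → Ω → (Fin D → ℝ)}
  {a : ℕ → Fin N → Ω → Fin K}

theorem IsPRUCBUP.isNonanticipating {α : ℝ} (hA : IsPRUCBUP 𝒰 I P α r c a) :
    IsNonanticipating 𝒰 P r c a :=
  ⟨hA.seed_le, hA.seed_indep, hA.adapted⟩

theorem IsEnvironment.measurable_envVector (hE : IsEnvironment I P r c)
    (k : (ℕ × Fin N × Fin K) ⊕ (ℕ × Fin N)) : Measurable (envVector r c k) := by
  rcases k with p | p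
  · exact hE.measurable_reward p.1 p.2.1 p.2.2
  · exact hE.measurable_pref p.1 p.2

theorem IsEnvironment.prefInfo_le (hE : IsEnvironment I P r c) : prefInfo c ≤ mΩ :=
  iSup₂_le fun t n => (hE.measurable_pref t n).comap_le

theorem IsEnvironment.otherInfo_le (hE : IsEnvironment I P r c) (hU : 𝒰 ≤ mΩ)
    (k : (ℕ × Fin N × Fin K) ⊕ (ℕ × Fin N)) : otherInfo 𝒰 r c k ≤ mΩ :=
  sup_le hU (iSup₂_le fun j _ => (hE.measurable_envVector j).comap_le)

theorem IsEnvironment.indep_otherInfo [IsProbabilityMeasure P] (hE : IsEnvironment I P r c)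
    (hU : 𝒰 ≤ mΩ) (hind : Indep 𝒰 (envInfo r c Set.univ) P)
    (k : (ℕ × Fin N × Fin K) ⊕ (ℕ × Fin N)) :
    Indep (MeasurableSpace.comap (envVector r c k) inferInstance) (otherInfo 𝒰 r c k) P :=
  indep_comap_sup_iSup_ne hE.measurable_envVector hE.indep hU
    (indep_of_indep_of_le_right hind (iSup_le comap_envVector_le_envInfo)) k

namespace IsNonanticipating

theorem measurableSet_arm_otherInfo (hA : IsNonanticipating 𝒰 P r c a) {s t : ℕ} (hs : 1 ≤ s)
    (hst : s ≤ t) (m n : Fin N) (i j : Fin K) :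
    MeasurableSet[otherInfo 𝒰 r c (Sum.inl (t, n, i))] {ω | a s m ω = j} :=
  ((hA.adapted s m hs).mono (history_le_otherInfo hst n i) le_rfl) (measurableSet_singleton j)

theorem measurable_arm (hA : IsNonanticipating 𝒰 P r c a) (hE : IsEnvironment I P r c)
    {t : ℕ} (ht : 1 ≤ t) (n : Fin N) : Measurable (a t n) := by
  refine (hA.adapted t n ht).mono (sup_le hA.seed_le ?_) le_rfl
  refine iSup₂_le fun s _ => iSup_le fun m => sup_le (hE.measurable_pref s m).comap_le ?_
  exact iSup_le fun i => (hE.measurable_reward s m i).comap_le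

theorem measurable_pullCount (hA : IsNonanticipating 𝒰 P r c a) (hE : IsEnvironment I P r c)
    (t : ℕ) (i : Fin K) : Measurable (pullCount a t i) :=
  Finset.measurable_fun_sum _ fun _ hs => Finset.measurable_fun_sum _ fun n _ =>
    Measurable.ite (hA.measurable_arm hE (Finset.mem_Ico.1 hs).1 n (measurableSet_singleton i))
      measurable_const measurable_const

theorem measurable_rewardNoise (hA : IsNonanticipating 𝒰 P r c a) (hE : IsEnvironment I P r c)
    (t : ℕ) (i : Fin K) : Measurable (rewardNoise I r a t i) :=
  Finset.measurable_fun_sum _ fun p hp =>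
    Measurable.ite (hA.measurable_arm hE (Finset.mem_Ico.1 (Finset.mem_product.1 hp).1).1 p.2
      (measurableSet_singleton i)) ((hE.measurable_reward p.1 p.2 i).sub_const _) measurable_const

theorem measurable_dotProduct_rewardNoise (hA : IsNonanticipating 𝒰 P r c a)
    (hE : IsEnvironment I P r c) {u : Ω → Fin D → ℝ} (hu : Measurable u) (t : ℕ) (i : Fin K) :
    Measurable fun ω => u ω ⬝ᵥ rewardNoise I r a t i ω := by
  have := hA.measurable_rewardNoise hE t i
  unfold dotProduct
  fun_prop

end IsNonanticipating

variable [IsProbabilityMeasure P]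

/-- The direction may depend on all preferences, even future ones, since rewards are independent of
these: conditionally on the preferences this is the usual Hoeffding supermartingale. -/
theorem lintegral_exp_dotProduct_rewardNoise_le_one (hE : IsEnvironment I P r c)
    (hA : IsNonanticipating 𝒰 P r c a) {u : Ω → Fin D → ℝ} (hu : Measurable[prefInfo c] u)
    (t : ℕ) (i : Fin K) :
    ∫⁻ ω, ENNReal.ofReal (Real.exp (u ω ⬝ᵥ rewardNoise I r a t i ω
      - pullCount a t i ω * ((∑ d, |u ω d|) ^ 2 / 8))) ∂P ≤ 1 := by
  let g : (Fin D → ℝ) → (Fin D → ℝ) → ENNReal := fun w x =>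
    ENNReal.ofReal (Real.exp (w ⬝ᵥ (x - I.meanReward i) - (∑ d, |w d|) ^ 2 / 8))
  have hg : Measurable (Function.uncurry g) := by
    simp only [Function.uncurry_def, g, dotProduct, Pi.sub_apply, ← Real.norm_eq_abs]
    fun_prop
  have hprob := I.reward_prob i
  have hone {p : ℕ × Fin N} (hp : p ∈ Finset.Ico 1 t ×ˢ Finset.univ) : 1 ≤ p.1 :=
    (Finset.mem_Ico.1 (Finset.mem_product.1 hp).1).1
  have hv (p q : ℕ × Fin N) (hq : q ∈ Finset.Ico 1 t ×ˢ Finset.univ) (hqp : q.1 ≤ p.1) :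
      Measurable[otherInfo 𝒰 r c (Sum.inl (p.1, p.2, i))]
        fun ω => if a q.1 q.2 ω = i then u ω else 0 :=
    Measurable.ite (hA.measurableSet_arm_otherInfo (hone hq) hqp q.2 p.2 i i)
      (hu.mono (prefInfo_le_otherInfo _) le_rfl) measurable_const
  have hX (p q : ℕ × Fin N) (hqp : q ≠ p) :
      Measurable[otherInfo 𝒰 r c (Sum.inl (p.1, p.2, i))] (r q.1 q.2 i) :=
    measurable_iff_comap_le.2 (comap_le_otherInfo (r := r) (c := c) (j := Sum.inl (q.1, q.2, i))
      fun h => hqp (by simpa [Prod.ext_iff] using h))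
  refine le_of_eq_of_le (lintegral_congr fun ω => ?_)
    (lintegral_prod_le_one_of_indep (Prod.fst : ℕ × Fin N → ℕ)
      (H := fun p => otherInfo 𝒰 r c (Sum.inl (p.1, p.2, i)))
      (fun p => hE.otherInfo_le hA.seed_le _) (fun p => hE.measurable_reward p.1 p.2 i)
      (fun p => hE.indep_otherInfo hA.seed_le hA.seed_indep (Sum.inl (p.1, p.2, i)))
      (fun p hp => hv p p hp le_rfl)
      (fun p _ q hq hqp hle => (hv p q hq hle).prodMk (hX p q hqp)) hg
      fun p w => by rw [hE.law_reward]; exact lintegral_exp_dotProduct_le_one (I.reward_mem i) w)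
  rw [dotProduct_rewardNoise_sub_eq_sum, Real.exp_sum,
    ENNReal.ofReal_prod_of_nonneg fun p _ => Real.exp_nonneg _]

theorem measureReal_pullCount_eq_and_le_rewardNoise (hE : IsEnvironment I P r c)
    (hA : IsNonanticipating 𝒰 P r c a) {u : Ω → Fin D → ℝ} (hu : Measurable[prefInfo c] u)
    (hu1 : ∀ ω, ∑ d, |u ω d| ≤ 1) (t : ℕ) (i : Fin K) (m : ℕ) {y : ℝ} (hy : 0 ≤ y) :
    P.real {ω | pullCount a t i ω = m ∧ m * y ≤ u ω ⬝ᵥ rewardNoise I r a t i ω}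
      ≤ Real.exp (-(2 * m * y ^ 2)) := by
  -- The exponent `4 y` is optimal for the variance proxy `1 / 4` of a variable in `[0, 1]`.
  have hmeas : Measurable fun ω => ((4 * y) • u ω) ⬝ᵥ rewardNoise I r a t i ω
      - pullCount a t i ω * ((∑ d, |((4 * y) • u ω) d|) ^ 2 / 8) := by
    have hu' : Measurable u := hu.mono hE.prefInfo_le le_rfl
    have h1 := hA.measurable_dotProduct_rewardNoise hE (hu'.const_smul (4 * y)) t i
    have h2 := hA.measurable_pullCount hE t i
    simp only [← Real.norm_eq_abs]
    fun_prop
  refine le_trans (measureReal_mono fun ω hω => ?_) (measureReal_le_exp_neg_of_lintegral_exp_le_one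
    hmeas (lintegral_exp_dotProduct_rewardNoise_le_one hE hA (hu.const_smul (4 * y)) t i)
    (2 * m * y ^ 2))
  obtain ⟨hm, hle⟩ := hω
  have hnorm : ∑ d, |((4 * y) • u ω) d| ≤ 4 * y := by
    simp only [Pi.smul_apply, smul_eq_mul, abs_mul, ← Finset.mul_sum]
    rw [abs_of_nonneg (by norm_num : (0:ℝ) ≤ 4), abs_of_nonneg hy]
    exact mul_le_of_le_one_right (by positivity) (hu1 ω)
  have hproxy : (m : ℝ) * ((∑ d, |((4 * y) • u ω) d|) ^ 2 / 8) ≤ m * ((4 * y) ^ 2 / 8) := by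
    gcongr
  have hdir := mul_le_mul_of_nonneg_left hle (by positivity : 0 ≤ 4 * y)
  rw [Set.mem_ofPred_eq, smul_dotProduct, smul_eq_mul, hm]
  linarith

theorem measureReal_noiseEvent_le (hE : IsEnvironment I P r c) (hA : IsNonanticipating 𝒰 P r c a)
    {u : Ω → Fin D → ℝ} (hu : Measurable[prefInfo c] u) (hu1 : ∀ ω, ∑ d, |u ω d| ≤ 1)
    (t : ℕ) (i : Fin K) {M : Set ℕ} {y : ℕ → ℝ} {b x : ℝ} (hx : 0 < x)
    (hM : ∀ m ∈ M, 1 ≤ m ∧ 0 ≤ y m ∧ b + m * x ≤ 2 * m * y m ^ 2) :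
    P.real (noiseEvent I r a u t i M y) ≤ Real.exp (-b) * (1 / x) := by
  classical
  let F : Finset ℕ := {m ∈ Finset.Icc 1 ((t - 1) * N) | m ∈ M}
  have hsub : noiseEvent I r a u t i M y ⊆
      ⋃ m ∈ F, {ω | pullCount a t i ω = m ∧ m * y m ≤ u ω ⬝ᵥ rewardNoise I r a t i ω} := by
    rintro ω ⟨hmem, hle⟩
    simp only [Set.mem_iUnion]
    exact ⟨_, Finset.mem_filter.2
      ⟨Finset.mem_Icc.2 ⟨(hM _ hmem).1, pullCount_le a t i ω⟩, hmem⟩, rfl, hle⟩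
  calc P.real (noiseEvent I r a u t i M y)
      ≤ ∑ m ∈ F, P.real
          {ω | pullCount a t i ω = m ∧ m * y m ≤ u ω ⬝ᵥ rewardNoise I r a t i ω} :=
        (measureReal_mono hsub (measure_ne_top _ _)).trans (measureReal_biUnion_finset_le _ _)
    _ ≤ ∑ m ∈ F, Real.exp (-b) * Real.exp (-(m * x)) := by
        refine Finset.sum_le_sum fun m hm => ?_
        obtain ⟨-, hy, hb⟩ := hM m (Finset.mem_filter.1 hm).2
        refine (measureReal_pullCount_eq_and_le_rewardNoise hE hA hu hu1 t i m hy).trans ?_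
        rw [← Real.exp_add, Real.exp_le_exp]
        linarith
    _ ≤ ∑ m ∈ Finset.Icc 1 ((t - 1) * N), Real.exp (-b) * Real.exp (-(m * x)) :=
        Finset.sum_le_sum_of_subset_of_nonneg (Finset.filter_subset _ _) fun _ _ _ => by positivity
    _ ≤ Real.exp (-b) * (1 / x) := by
        rw [← Finset.mul_sum]
        gcongr
        exact sum_exp_neg_mul_le hx _

end Sampling

end Trajectory

section Confidence

variable {N K D : ℕ} {Ω : Type*}

/-- The `ℓ¹`-normalized preference estimate. Deviations are measured in this direction because its
length `1`, unlike that of the estimate itself, is deterministic (or `0` for a zero estimate). -/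
noncomputable def unitPref (c : ℕ → Fin N → Ω → (Fin D → ℝ)) (t : ℕ) (n : Fin N) (ω : Ω) :
    Fin D → ℝ :=
  (∑ d, |prefEst c t n ω d|)⁻¹ • prefEst c t n ω

section UnitPref

variable (c : ℕ → Fin N → Ω → (Fin D → ℝ)) (t : ℕ) (n : Fin N)

theorem sum_abs_unitPref_le_one (ω : Ω) : ∑ d, |unitPref c t n ω d| ≤ 1 := by
  have h0 : 0 ≤ ∑ d, |prefEst c t n ω d| := Finset.sum_nonneg fun _ _ => abs_nonneg _
  simp only [unitPref, Pi.smul_apply, smul_eq_mul, abs_mul, abs_inv, abs_of_nonneg h0]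
  rw [← Finset.mul_sum]
  exact inv_mul_le_one

theorem measurable_prefEst [MeasurableSpace Ω] (h : ∀ s, Measurable (c s n)) :
    Measurable (prefEst c t n) := by
  unfold prefEst
  fun_prop

theorem measurable_unitPref [MeasurableSpace Ω] (h : ∀ s, Measurable (c s n)) :
    Measurable (unitPref c t n) := by
  have hest := measurable_prefEst c t n h
  unfold unitPref
  simp only [← Real.norm_eq_abs]
  fun_prop

theorem measurable_prefInfo_unitPref : Measurable[prefInfo c] (unitPref c t n) :=
  @measurable_unitPref _ _ _ c t n (prefInfo c)
    fun s => measurable_iff_comap_le.2 (le_iSup₂_of_le s n le_rfl)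

variable {c t n} {ω : Ω}

theorem sum_prefEst_smul_unitPref (hw : ∀ d, 0 ≤ prefEst c t n ω d) :
    (∑ d, prefEst c t n ω d) • unitPref c t n ω = prefEst c t n ω := by
  simp only [unitPref, abs_of_nonneg (hw _), smul_smul]
  by_cases h : ∑ d, prefEst c t n ω d = 0
  · have hzero := (Finset.sum_eq_zero_iff_of_nonneg fun d _ => hw d).1 h
    have : prefEst c t n ω = 0 := funext fun d => hzero d (Finset.mem_univ d)
    simp [this]
  · rw [mul_inv_cancel₀ h, one_smul]

end UnitPref

section RewardEst

variable (I : Bandit N K D) (r : ℕ → Fin N → Fin K → Ω → (Fin D → ℝ)) (a : ℕ → Fin N → Ω → Fin K)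
  {t : ℕ} {i : Fin K} {ω : Ω}

theorem rewardEst_eq_add_rewardNoise (h : pullCount a t i ω ≠ 0) :
    rewardEst r a t i ω =
      I.meanReward i + (pullCount a t i ω : ℝ)⁻¹ • rewardNoise I r a t i ω := by
  have hsum : ∑ s ∈ Finset.Ico 1 t, ∑ n : Fin N, (if a s n ω = i then r s n (a s n ω) ω else 0) =
      rewardNoise I r a t i ω + (pullCount a t i ω : ℝ) • I.meanReward i := by
    rw [rewardNoise, pullCount_eq_sum_product, ← Finset.sum_product', Nat.cast_sum,
      Finset.sum_smul, ← Finset.sum_add_distrib]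
    refine Finset.sum_congr rfl fun p _ => ?_
    by_cases hp : a p.1 p.2 ω = i <;> simp [hp]
  rw [rewardEst, hsum, smul_add, smul_smul, inv_mul_cancel₀ (Nat.cast_ne_zero.2 h), one_smul,
    add_comm]

theorem rewardEst_eq_zero (h : pullCount a t i ω = 0) : rewardEst r a t i ω = 0 := by
  rw [rewardEst, h, Nat.cast_zero, inv_zero, zero_smul]

end RewardEst

section Optimism

variable {I : Bandit N K D} {α η : ℝ}
  {r : ℕ → Fin N → Fin K → Ω → (Fin D → ℝ)} {c : ℕ → Fin N → Ω → (Fin D → ℝ)}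
  {a : ℕ → Fin N → Ω → Fin K} {t : ℕ} {n : Fin N} {i : Fin K} {ω : Ω}

theorem ucbIndex_eq_of_pullCount_eq_zero (h : pullCount a t i ω = 0) :
    ucbIndex α r c a t n i ω = (∑ d, prefEst c t n ω d) * √(Real.log (t / α)) := by
  rw [ucbIndex, rewardEst_eq_zero r a h, bonus, h]
  simp [dotProduct, Finset.sum_mul]

theorem ucbIndex_eq_of_pullCount_ne_zero (hw : ∀ d, 0 ≤ prefEst c t n ω d)
    (h : pullCount a t i ω ≠ 0) :
    ucbIndex α r c a t n i ω = prefEst c t n ω ⬝ᵥ I.meanReward i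
      + (∑ d, prefEst c t n ω d) *
        ((pullCount a t i ω : ℝ)⁻¹ * (unitPref c t n ω ⬝ᵥ rewardNoise I r a t i ω)
          + √(Real.log (t / α) / pullCount a t i ω)) := by
  have hnoise : prefEst c t n ω ⬝ᵥ rewardNoise I r a t i ω =
      (∑ d, prefEst c t n ω d) * (unitPref c t n ω ⬝ᵥ rewardNoise I r a t i ω) := by
    rw [← smul_eq_mul, ← smul_dotProduct, sum_prefEst_smul_unitPref hw]
  have hbonus : (prefEst c t n ω ⬝ᵥ fun _ => bonus α a t i ω) =
      (∑ d, prefEst c t n ω d) * √(Real.log (t / α) / pullCount a t i ω) := by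
    rw [dotProduct, Finset.sum_mul, bonus,
      max_eq_right (Nat.one_le_cast.2 (Nat.one_le_iff_ne_zero.2 h))]
  rw [ucbIndex, dotProduct_add, rewardEst_eq_add_rewardNoise I r a h, dotProduct_add,
    dotProduct_smul, smul_eq_mul, hnoise, hbonus]
  ring

variable (hw : ∀ d, 0 ≤ prefEst c t n ω d) (hwδ : ∑ d, prefEst c t n ω d ≤ I.delta)
include hw hwδ

theorem ucbIndex_le_of_lt_pullCount (hδ : 0 < I.delta) (hη : 0 ≤ η) (hL : 0 ≤ Real.log (t / α))
    (hm : 128 * Real.log (t / α) * I.delta ^ 2 < pullCount a t i ω * η ^ 2)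
    (hnoise : unitPref c t n ω ⬝ᵥ rewardNoise I r a t i ω
      ≤ pullCount a t i ω * (η / (8 * I.delta))) :
    ucbIndex α r c a t n i ω ≤ prefEst c t n ω ⬝ᵥ I.meanReward i + η / 4 := by
  have hne : pullCount a t i ω ≠ 0 := by
    rintro h
    rw [h, Nat.cast_zero, zero_mul] at hm
    exact hm.not_ge (by positivity)
  have hpos : (0 : ℝ) < pullCount a t i ω := Nat.cast_pos.2 (Nat.pos_of_ne_zero hne)
  have hmean : (pullCount a t i ω : ℝ)⁻¹ * (unitPref c t n ω ⬝ᵥ rewardNoise I r a t i ω)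
      ≤ η / (8 * I.delta) := (inv_mul_le_iff₀ hpos).2 hnoise
  have hbonus : √(Real.log (t / α) / pullCount a t i ω) ≤ η / (8 * I.delta) := by
    refine Real.sqrt_le_iff.2 ⟨by positivity, ?_⟩
    rw [div_pow, div_le_div_iff₀ hpos (by positivity)]
    nlinarith [mul_nonneg hL (sq_nonneg I.delta)]
  rw [ucbIndex_eq_of_pullCount_ne_zero hw hne]
  gcongr
  calc _ ≤ I.delta * (η / (8 * I.delta) + η / (8 * I.delta)) := by
        refine mul_le_mul_of_nonneg hwδ (add_le_add hmean hbonus)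
          (Finset.sum_nonneg fun d _ => hw d) (by positivity)
    _ = η / 4 := by field_simp; ring

theorem le_ucbIndex_of_noise (hδ : 0 < I.delta) (hη : 0 ≤ η) (hL : 1 ≤ Real.log (t / α))
    (hnoise : pullCount a t i ω ≠ 0 → (-unitPref c t n ω) ⬝ᵥ rewardNoise I r a t i ω
      ≤ pullCount a t i ω * (√(Real.log (t / α) / pullCount a t i ω) + η / (4 * I.delta))) :
    prefEst c t n ω ⬝ᵥ I.meanReward i - η / 4 ≤ ucbIndex α r c a t n i ω := by
  have hW : 0 ≤ ∑ d, prefEst c t n ω d := Finset.sum_nonneg fun d _ => hw d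
  by_cases hm : pullCount a t i ω = 0
  · have hmean : prefEst c t n ω ⬝ᵥ I.meanReward i ≤ ∑ d, prefEst c t n ω d :=
      Finset.sum_le_sum fun d _ => mul_le_of_le_one_right (hw d) (I.meanReward_mem i d).2
    have hbonus := mul_le_mul_of_nonneg_left (Real.one_le_sqrt.2 hL) hW
    rw [ucbIndex_eq_of_pullCount_eq_zero hm]
    linarith
  · have hpos : (0 : ℝ) < pullCount a t i ω := Nat.cast_pos.2 (Nat.pos_of_ne_zero hm)
    have hdev := (inv_mul_le_iff₀ hpos).2 (hnoise hm)
    rw [neg_dotProduct, mul_neg] at hdev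
    have hexcess := mul_le_mul_of_nonneg_left (sub_nonneg.2 hdev) hW
    have hslack : (∑ d, prefEst c t n ω d) * (η / (4 * I.delta)) ≤ η / 4 := by
      calc _ ≤ I.delta * (η / (4 * I.delta)) := by gcongr
        _ = η / 4 := by field_simp
    rw [ucbIndex_eq_of_pullCount_ne_zero (I := I) hw hm]
    linarith

end Optimism

end Confidence

section Oversampling

variable {N K D : ℕ} {Ω : Type*}

/-- The event that user `n` is served arm `i` at round `t` under a precise preference estimate,
although `i` has been sampled often enough to resolve its gap. -/
def oversampledEvent (I : Bandit N K D) (best : ℕ → Fin N → Fin K) (α : ℝ)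
    (c : ℕ → Fin N → Ω → (Fin D → ℝ)) (a : ℕ → Fin N → Ω → Fin K) (t : ℕ) (n : Fin N)
    (i : Fin K) : Set Ω :=
  {ω | a t n ω = i ∧ ¬ PrefError I best c a t n ω ∧
    128 * Real.log (t / α) * I.delta ^ 2 < pullCount a t i ω * I.gap best t n i ^ 2}

variable {𝒰 : MeasurableSpace Ω} [mΩ : MeasurableSpace Ω] {I : Bandit N K D}
  {P : Measure Ω} {α : ℝ}
  {r : ℕ → Fin N → Fin K → Ω → (Fin D → ℝ)} {c : ℕ → Fin N → Ω → (Fin D → ℝ)}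
  {a : ℕ → Fin N → Ω → Fin K} {best : ℕ → Fin N → Fin K} {t : ℕ} {n : Fin N} {i : Fin K}

/-- If both arms were well estimated, the index of the suboptimal arm would exceed its estimated
value by at most `η / 4`, and that of the optimal arm would fall below by at most `η / 4`, which a
precise preference estimate does not allow. -/
theorem oversampledEvent_ae_le_noiseEvent_union (hE : IsEnvironment I P r c)
    (hA : IsPRUCBUP 𝒰 I P α r c a) (ht : 1 ≤ t) (hbest : I.IsBestArm t n (best t n))
    (hδ : 0 < I.delta) (hgap : 0 ≤ I.gap best t n i) (hL : 1 ≤ Real.log (t / α)) :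
    oversampledEvent I best α c a t n i ≤ᵐ[P]
      (noiseEvent I r a (unitPref c t n) t i
          {m | 128 * Real.log (t / α) * I.delta ^ 2 < m * I.gap best t n i ^ 2}
          (fun _ => I.gap best t n i / (8 * I.delta)) ∪
        noiseEvent I r a (-unitPref c t n) t (best t n) {m | m ≠ 0}
          (fun m => √(Real.log (t / α) / m) + I.gap best t n i / (4 * I.delta)) : Set Ω) := by
  filter_upwards [hE.ae_prefEst t n] with ω ⟨hw, hwδ⟩ ⟨hai, hpref, hm⟩
  by_contra hnot
  obtain ⟨hi, hj⟩ := not_or.1 hnot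
  have hupper := ucbIndex_le_of_lt_pullCount hw hwδ hδ hgap (by linarith) hm
    (not_lt.1 fun h => hi ⟨hm, h.le⟩)
  have hlower := le_ucbIndex_of_noise hw hwδ hδ hgap hL fun h =>
    not_lt.1 fun h' => hj ⟨h, h'.le⟩
  have hmax := hA.isMax t n ω ht (best t n) hbest.1
  rw [PrefError, hai, not_le, dotProduct_sub] at hpref
  rw [hai] at hmax
  linarith

variable [IsProbabilityMeasure P]

theorem measureReal_noiseEvent_unitPref_le (hE : IsEnvironment I P r c)
    (hA : IsNonanticipating 𝒰 P r c a) {L δ η : ℝ} (hL : 0 ≤ L) (hδ : 0 < δ) (hη : 0 < η) :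
    P.real (noiseEvent I r a (unitPref c t n) t i {m | 128 * L * δ ^ 2 < m * η ^ 2}
      fun _ => η / (8 * δ)) ≤ 64 * (δ ^ 2 / η ^ 2) * Real.exp (-(2 * L)) := by
  refine (measureReal_noiseEvent_le hE hA (measurable_prefInfo_unitPref c t n)
    (sum_abs_unitPref_le_one c t n) t i (b := 2 * L) (x := η ^ 2 / (64 * δ ^ 2)) (by positivity)
    fun m hm => ⟨?_, by positivity, ?_⟩).trans_eq (by field_simp)
  · rw [Nat.one_le_iff_ne_zero]
    rintro rfl
    rw [Set.mem_ofPred_eq, Nat.cast_zero, zero_mul] at hm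
    exact hm.not_ge (by positivity)
  · have hlog : 2 * L ≤ m * η ^ 2 / (64 * δ ^ 2) := by
      rw [le_div_iff₀ (by positivity)]
      linarith [Set.mem_ofPred_eq ▸ hm]
    calc 2 * L + m * (η ^ 2 / (64 * δ ^ 2))
        ≤ m * η ^ 2 / (64 * δ ^ 2) + m * (η ^ 2 / (64 * δ ^ 2)) := by gcongr
      _ = 2 * m * (η / (8 * δ)) ^ 2 := by field_simp; ring

theorem measureReal_noiseEvent_neg_unitPref_le (hE : IsEnvironment I P r c)
    (hA : IsNonanticipating 𝒰 P r c a) {L δ η : ℝ} (hL : 0 ≤ L) (hδ : 0 < δ) (hη : 0 < η) :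
    P.real (noiseEvent I r a (-unitPref c t n) t i {m | m ≠ 0} fun m => √(L / m) + η / (4 * δ))
      ≤ 8 * (δ ^ 2 / η ^ 2) * Real.exp (-(2 * L)) := by
  refine (measureReal_noiseEvent_le hE hA (measurable_prefInfo_unitPref c t n).neg
    (fun ω => by simpa using sum_abs_unitPref_le_one c t n ω) t i (b := 2 * L)
    (x := η ^ 2 / (8 * δ ^ 2)) (by positivity)
    fun m hm => ⟨Nat.one_le_iff_ne_zero.2 hm, by positivity, ?_⟩).trans_eq (by field_simp)
  have hpos : (0 : ℝ) < m := Nat.cast_pos.2 (Nat.pos_of_ne_zero hm)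
  calc 2 * L + m * (η ^ 2 / (8 * δ ^ 2))
      = 2 * m * (√(L / m) ^ 2 + (η / (4 * δ)) ^ 2) := by
        rw [Real.sq_sqrt (by positivity)]
        field_simp
        ring
    _ ≤ 2 * m * (√(L / m) + η / (4 * δ)) ^ 2 := by
        gcongr
        have : 0 ≤ √(L / m) * (η / (4 * δ)) := by positivity
        linarith [add_sq (√(L / m)) (η / (4 * δ))]

theorem exp_neg_two_mul_log_div_le {x : ℝ} (hα : 0 < α) (hα1 : α ≤ 1) (hx : 0 < x) :
    Real.exp (-(2 * Real.log (x / α))) ≤ 1 / x ^ 2 := by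
  have hxα : x ≤ x / α := le_div_self hx.le hα hα1
  rw [Real.exp_neg, mul_comm, Real.exp_mul, Real.exp_log (by positivity), ← one_div,
    Real.rpow_two]
  gcongr

/-- The estimate is void for `t ≤ 2`, where the logarithm may be less than `1`. -/
theorem measureReal_oversampledEvent_le (hE : IsEnvironment I P r c) (hα : 0 < α) (hα1 : α ≤ 1)
    (hA : IsPRUCBUP 𝒰 I P α r c a) (hbest : I.IsBestArm t n (best t n)) (ht : 1 ≤ t)
    (hgap : 0 < I.gap best t n i) :
    P.real (oversampledEvent I best α c a t n i)
      ≤ 72 * (I.delta ^ 2 / I.gap best t n i ^ 2) * (1 / (t : ℝ) ^ 2) := by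
  have hle : I.gap best t n i ≤ I.delta := I.gap_le_delta best t n i
  have hδ : 0 < I.delta := hgap.trans_le hle
  have ht0 : (0 : ℝ) < t := Nat.cast_pos.2 ht
  obtain ht2 | ht3 := Nat.lt_or_ge t 3
  · have hratio : 1 ≤ I.delta ^ 2 / I.gap best t n i ^ 2 := by
      rw [one_le_div (by positivity)]
      gcongr
    have hsq : 1 / 4 ≤ 1 / (t : ℝ) ^ 2 := by
      have : (t : ℝ) ≤ 2 := by exact_mod_cast Nat.le_of_lt_succ ht2
      gcongr
      nlinarith
    refine measureReal_le_one.trans ?_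
    nlinarith
  have hL : 1 ≤ Real.log (t / α) := by
    rw [Real.le_log_iff_exp_le (by positivity)]
    have h3 : (3 : ℝ) ≤ t := by exact_mod_cast ht3
    linarith [Real.exp_one_lt_three, le_div_self ht0.le hα hα1]
  have hsub := oversampledEvent_ae_le_noiseEvent_union hE hA ht hbest hδ hgap.le hL
  calc P.real (oversampledEvent I best α c a t n i)
      ≤ P.real (_ ∪ _) := ENNReal.toReal_mono (measure_ne_top _ _) (measure_mono_ae hsub)
    _ ≤ 64 * (I.delta ^ 2 / I.gap best t n i ^ 2) * Real.exp (-(2 * Real.log (t / α)))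
        + 8 * (I.delta ^ 2 / I.gap best t n i ^ 2) * Real.exp (-(2 * Real.log (t / α))) :=
        (measureReal_union_le _ _).trans (add_le_add
          (measureReal_noiseEvent_unitPref_le hE hA.isNonanticipating (by linarith) hδ hgap)
          (measureReal_noiseEvent_neg_unitPref_le hE hA.isNonanticipating (by linarith) hδ hgap))
    _ = 72 * (I.delta ^ 2 / I.gap best t n i ^ 2) * Real.exp (-(2 * Real.log (t / α))) := by ring
    _ ≤ _ := by
        gcongr
        exact exp_neg_two_mul_log_div_le hα hα1 ht0

end Oversampling

section RewardRegret

open scoped Finset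

variable {N K D : ℕ} {Ω : Type*}

theorem card_filter_le_pullCount_add_one (a : ℕ → Fin N → Ω → Fin K) {n : Fin N} {i : Fin K}
    {ω : Ω} {F : Finset ℕ} (hF : ∀ s ∈ F, 1 ≤ s ∧ a s n ω = i) (t : ℕ) :
    #{s ∈ F | s ≤ t} ≤ pullCount a t i ω + 1 := by
  have hsub : {s ∈ F | s ≤ t} ⊆ insert t {s ∈ Finset.Ico 1 t | a s n ω = i} := by
    intro s hs
    obtain ⟨hsF, hst⟩ := Finset.mem_filter.1 hs
    obtain ⟨hs1, hsi⟩ := hF s hsF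
    simp only [Finset.mem_insert, Finset.mem_filter, Finset.mem_Ico]
    exact hst.eq_or_lt.imp_right fun hlt => ⟨⟨hs1, hlt⟩, hsi⟩
  refine (Finset.card_le_card hsub).trans ((Finset.card_insert_le _ _).trans
    (Nat.add_le_add_right ?_ 1))
  rw [Finset.card_filter]
  exact Finset.sum_le_sum fun s _ => Finset.single_le_sum
    (f := fun m : Fin N => if a s m ω = i then 1 else 0) (fun _ _ => Nat.zero_le _)
    (Finset.mem_univ n)

/-- The event that user `n` is served arm `i` at round `t`, and `i` has not been sampled often
enough to resolve its gap, on the scale set by the budget `B`. -/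
def undersampledEvent (I : Bandit N K D) (best : ℕ → Fin N → Fin K)
    (a : ℕ → Fin N → Ω → Fin K) (B : ℝ) (t : ℕ) (n : Fin N) (i : Fin K) : Set Ω :=
  {ω | a t n ω = i ∧ pullCount a t i ω * I.gap best t n i ^ 2 ≤ B}

theorem sum_indicator_undersampledEvent_le {I : Bandit N K D} {best : ℕ → Fin N → Fin K} {T : ℕ}
    (a : ℕ → Fin N → Ω → Fin K) {n : Fin N} {i : Fin K}
    (hne : (I.subRounds best T n i).Nonempty) {B : ℝ} (hB : 0 ≤ B) (ω : Ω) :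
    ∑ t ∈ I.subRounds best T n i,
        (undersampledEvent I best a B t n i).indicator (fun _ => I.gap best t n i) ω
      ≤ 2 * ((B + I.delta ^ 2) / I.gapMin best T n i) := by
  classical
  simp only [Set.indicator_apply, ← Finset.sum_filter]
  refine sum_le_of_rank_mul_sq_le (x := fun t => I.gap best t n i) (by positivity)
    (Bandit.gapMin_pos hne) (fun t ht => Bandit.gapMin_le (Finset.mem_filter.1 ht).1) ?_
  intro t ht
  obtain ⟨ht_sub, -, hcount⟩ := Finset.mem_filter.1 ht
  have hrank := card_filter_le_pullCount_add_one a (ω := ω) (n := n) (i := i) (t := t)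
    (F := {s ∈ I.subRounds best T n i | ω ∈ undersampledEvent I best a B s n i}) fun s hs =>
      have hs := Finset.mem_filter.1 hs
      ⟨(Bandit.mem_subRounds.1 hs.1).1.1, hs.2.1⟩
  have hgap : I.gap best t n i ^ 2 ≤ I.delta ^ 2 :=
    pow_le_pow_left₀ (Bandit.mem_subRounds.1 ht_sub).2.2.le (Bandit.gap_le_delta best t n i) 2
  calc _ ≤ ((pullCount a t i ω + 1 : ℕ) : ℝ) * I.gap best t n i ^ 2 := by gcongr
    _ ≤ B + I.delta ^ 2 := by push_cast; linarith

theorem prefError_one {I : Bandit N K D} {best : ℕ → Fin N → Fin K}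
    (c : ℕ → Fin N → Ω → (Fin D → ℝ)) {a : ℕ → Fin N → Ω → Fin K} {n : Fin N} {ω : Ω}
    (hbest : I.IsBestArm 1 n (best 1 n)) (ha : a 1 n ω ∈ I.armSet 1 n) :
    PrefError I best c a 1 n ω := by
  have hest : prefEst c 1 n ω = 0 := by simp [prefEst]
  rw [PrefError, hest, zero_dotProduct]
  exact div_nonneg (Bandit.gap_nonneg hbest ha) zero_le_two

variable {𝒰 : MeasurableSpace Ω} [mΩ : MeasurableSpace Ω] {I : Bandit N K D}
  {P : Measure Ω} [IsProbabilityMeasure P] {α : ℝ}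
  {r : ℕ → Fin N → Fin K → Ω → (Fin D → ℝ)} {c : ℕ → Fin N → Ω → (Fin D → ℝ)}
  {a : ℕ → Fin N → Ω → Fin K} {best : ℕ → Fin N → Fin K} {T : ℕ} {n : Fin N} {i : Fin K}

theorem sum_gap_mul_prefError_le (hE : IsEnvironment I P r c) (a : ℕ → Fin N → Ω → Fin K)
    (hbest : ∀ t n, I.IsBestArm t n (best t n)) (hne : (I.subRounds best T n i).Nonempty) :
    ∑ t ∈ I.subRounds best T n i,
        I.gap best t n i * P.real {ω | a t n ω = i ∧ PrefError I best c a t n ω}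
      ≤ 96 * ((D : ℝ) ^ 2 * I.distMax best T n i ^ 2 * I.delta ^ 2 / I.gapMin best T n i) := by
  have hy := Bandit.gapMin_pos hne
  obtain ⟨t₀, ht₀⟩ := hne
  have hδρ : 0 < I.delta * I.distMax best T n i :=
    hy.trans_le ((Bandit.gapMin_le ht₀).trans
      (Bandit.gap_le_delta_mul_distMax (hbest t₀ n) ht₀))
  have hD : (1 : ℝ) ≤ (D : ℝ) ^ 2 := one_le_pow₀ (by exact_mod_cast Bandit.one_le_dim ht₀)
  have htail : ∀ t ∈ I.subRounds best T n i,
      P.real {ω | a t n ω = i ∧ PrefError I best c a t n ω} ≤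
        2 * Real.exp
          (-(t * I.gap best t n i ^ 2 / (16 * (I.delta * I.distMax best T n i) ^ 2))) := by
    intro t ht
    obtain ⟨⟨ht1, -⟩, -, hgap⟩ := Bandit.mem_subRounds.1 ht
    refine (measureReal_mono ?_).trans (hE.measure_prefEst_dotProduct_le_two_mul n
      (Bandit.distMax_nonneg ht) (Bandit.abs_meanReward_sub_le_distMax (hbest t n) ht) hgap.le ht1)
    rintro ω ⟨hi, herr⟩
    rwa [PrefError, hi] at herr
  have hsum := sum_mul_exp_neg_mul_sq_le (n := T) (S := I.subRounds best T n i)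
    (x := fun t => I.gap best t n i) (A := 16 * (I.delta * I.distMax best T n i) ^ 2)
    (by positivity) hy (Finset.filter_subset _ _) fun t ht => Bandit.gapMin_le ht
  calc _ ≤ ∑ t ∈ I.subRounds best T n i, 2 * (I.gap best t n i *
          Real.exp (-(t * I.gap best t n i ^ 2 / (16 * (I.delta * I.distMax best T n i) ^ 2)))) :=
        Finset.sum_le_sum fun t ht => (mul_le_mul_of_nonneg_left (htail t ht)
          (Bandit.mem_subRounds.1 ht).2.2.le).trans_eq (mul_left_comm _ _ _)
    _ ≤ 2 * (3 * (16 * (I.delta * I.distMax best T n i) ^ 2 / I.gapMin best T n i)) := by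
        rw [← Finset.mul_sum]
        gcongr
    _ = 96 * (1 * I.distMax best T n i ^ 2 * I.delta ^ 2 / I.gapMin best T n i) := by ring
    _ ≤ _ := by gcongr

theorem sum_gap_mul_undersampledEvent_le (hE : IsEnvironment I P r c)
    (hA : IsNonanticipating 𝒰 P r c a) (hne : (I.subRounds best T n i).Nonempty) {B : ℝ}
    (hB : 0 ≤ B) :
    ∑ t ∈ I.subRounds best T n i, I.gap best t n i * P.real (undersampledEvent I best a B t n i)
      ≤ 2 * ((B + I.delta ^ 2) / I.gapMin best T n i) := by
  have hmeas : ∀ t ∈ I.subRounds best T n i,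
      MeasurableSet (undersampledEvent I best a B t n i) := by
    intro t ht
    have harm := hA.measurable_arm hE (Bandit.mem_subRounds.1 ht).1.1 n (measurableSet_singleton i)
    have hcount : Measurable fun ω => (pullCount a t i ω : ℝ) * I.gap best t n i ^ 2 :=
      (measurable_from_top.comp (hA.measurable_pullCount hE t i)).mul_const _
    exact harm.inter (measurableSet_le hcount measurable_const)
  have hint : ∀ t ∈ I.subRounds best T n i, Integrable
      ((undersampledEvent I best a B t n i).indicator fun _ => I.gap best t n i) P :=
    fun t ht => (integrable_const _).indicator (hmeas t ht)
  calc _ = ∫ ω, ∑ t ∈ I.subRounds best T n i,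
          (undersampledEvent I best a B t n i).indicator (fun _ => I.gap best t n i) ω ∂P := by
        rw [integral_finsetSum _ hint]
        refine Finset.sum_congr rfl fun t ht => ?_
        rw [integral_indicator_const _ (hmeas t ht), smul_eq_mul, mul_comm]
    _ ≤ ∫ _, 2 * ((B + I.delta ^ 2) / I.gapMin best T n i) ∂P :=
        integral_mono (integrable_finsetSum _ hint) (integrable_const _)
          (sum_indicator_undersampledEvent_le a hne hB)
    _ = _ := by simp

theorem sum_gap_mul_oversampledEvent_le (hE : IsEnvironment I P r c) (hα : 0 < α) (hα1 : α ≤ 1)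
    (hA : IsPRUCBUP 𝒰 I P α r c a) (hbest : ∀ t n, I.IsBestArm t n (best t n))
    (hne : (I.subRounds best T n i).Nonempty) :
    ∑ t ∈ I.subRounds best T n i, I.gap best t n i * P.real (oversampledEvent I best α c a t n i)
      ≤ 144 * (I.delta ^ 2 / I.gapMin best T n i) := by
  have hy := Bandit.gapMin_pos hne
  have hterm : ∀ t ∈ I.subRounds best T n i,
      I.gap best t n i * P.real (oversampledEvent I best α c a t n i)
        ≤ 72 * (I.delta ^ 2 / I.gapMin best T n i) * ((t : ℝ) ^ 2)⁻¹ := by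
    intro t ht
    obtain ⟨⟨ht1, -⟩, -, hgap⟩ := Bandit.mem_subRounds.1 ht
    calc _ ≤ I.gap best t n i *
            (72 * (I.delta ^ 2 / I.gap best t n i ^ 2) * (1 / (t : ℝ) ^ 2)) := by
          gcongr
          exact measureReal_oversampledEvent_le hE hα hα1 hA (hbest t n) ht1 hgap
      _ = 72 * (I.delta ^ 2 / I.gap best t n i) * ((t : ℝ) ^ 2)⁻¹ := by field_simp
      _ ≤ _ := by
          gcongr
          exact Bandit.gapMin_le ht
  have hsub : I.subRounds best T n i ⊆ Finset.Ioo 0 (T + 1) := fun t ht => by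
    have := (Bandit.mem_subRounds.1 ht).1
    exact Finset.mem_Ioo.2 ⟨this.1, Nat.lt_succ_of_le this.2⟩
  have hsq : ∑ t ∈ I.subRounds best T n i, ((t : ℝ) ^ 2)⁻¹ ≤ 2 :=
    (Finset.sum_le_sum_of_subset_of_nonneg hsub fun _ _ _ => by positivity).trans
      ((sum_Ioo_inv_sq_le (α := ℝ) 0 (T + 1)).trans_eq (by norm_num))
  calc _ ≤ _ := Finset.sum_le_sum hterm
    _ ≤ 72 * (I.delta ^ 2 / I.gapMin best T n i) * 2 := by
        rw [← Finset.mul_sum]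
        gcongr
    _ = _ := by ring

theorem sum_gap_mul_not_prefError_le_add (hE : IsEnvironment I P r c) (hα : 0 < α) (hα1 : α ≤ 1)
    (hA : IsPRUCBUP 𝒰 I P α r c a) (hbest : ∀ t n, I.IsBestArm t n (best t n))
    (hne : (I.subRounds best T n i).Nonempty) :
    ∑ t ∈ I.subRounds best T n i,
        I.gap best t n i * P.real {ω | a t n ω = i ∧ ¬ PrefError I best c a t n ω}
      ≤ 256 * (I.delta ^ 2 * Real.log (T / α) / I.gapMin best T n i)
        + 146 * (I.delta ^ 2 / I.gapMin best T n i) := by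
  set B := 128 * Real.log (T / α) * I.delta ^ 2
  have hlog : ∀ t ∈ I.subRounds best T n i,
      0 ≤ Real.log (t / α) ∧ Real.log (t / α) ≤ Real.log (T / α) := by
    intro t ht
    obtain ⟨ht1, htT⟩ := (Bandit.mem_subRounds.1 ht).1
    have ht1' : (1 : ℝ) ≤ t := by exact_mod_cast ht1
    exact ⟨Real.log_nonneg (ht1'.trans (le_div_self (by linarith) hα hα1)), by gcongr⟩
  have hB : 0 ≤ B := by
    obtain ⟨t, ht⟩ := hne
    have := (hlog t ht).1.trans (hlog t ht).2
    positivity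
  have hcover : ∀ t ∈ I.subRounds best T n i,
      {ω | a t n ω = i ∧ ¬ PrefError I best c a t n ω}
        ⊆ undersampledEvent I best a B t n i ∪ oversampledEvent I best α c a t n i := by
    rintro t ht ω ⟨hi, hpref⟩
    refine (le_or_gt _ _).imp (fun h => ⟨hi, h.trans ?_⟩) fun h => ⟨hi, hpref, h⟩
    exact mul_le_mul_of_nonneg_right
      (mul_le_mul_of_nonneg_left (hlog t ht).2 (by norm_num)) (sq_nonneg _)
  calc _ ≤ ∑ t ∈ I.subRounds best T n i,
          (I.gap best t n i * P.real (undersampledEvent I best a B t n i)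
            + I.gap best t n i * P.real (oversampledEvent I best α c a t n i)) :=
        Finset.sum_le_sum fun t ht => (mul_le_mul_of_nonneg_left
          ((measureReal_mono (hcover t ht) (measure_ne_top _ _)).trans (measureReal_union_le _ _))
          (Bandit.mem_subRounds.1 ht).2.2.le).trans_eq (mul_add _ _ _)
    _ ≤ 2 * ((B + I.delta ^ 2) / I.gapMin best T n i)
          + 144 * (I.delta ^ 2 / I.gapMin best T n i) := by
        rw [Finset.sum_add_distrib]
        exact add_le_add (sum_gap_mul_undersampledEvent_le hE hA.isNonanticipating hne hB)
          (sum_gap_mul_oversampledEvent_le hE hα hα1 hA hbest hne)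
    _ = _ := by ring

/-- At the first round every pull counts as a preference error, and from `T = 2` on the logarithm
is at least `log 2`, so that it absorbs the constant. -/
theorem sum_gap_mul_not_prefError_le (hE : IsEnvironment I P r c) (hα : 0 < α) (hα1 : α ≤ 1)
    (hA : IsPRUCBUP 𝒰 I P α r c a) (hbest : ∀ t n, I.IsBestArm t n (best t n))
    (hne : (I.subRounds best T n i).Nonempty) :
    ∑ t ∈ I.subRounds best T n i,
        I.gap best t n i * P.real {ω | a t n ω = i ∧ ¬ PrefError I best c a t n ω}
      ≤ 548 * (I.delta ^ 2 * Real.log (T / α) / I.gapMin best T n i) := by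
  have hy := Bandit.gapMin_pos hne
  have hle := sum_gap_mul_not_prefError_le_add hE hα hα1 hA hbest hne
  obtain ⟨t₀, ht₀⟩ := hne
  obtain ⟨ht₀1, ht₀T⟩ := (Bandit.mem_subRounds.1 ht₀).1
  have hTα : (T : ℝ) ≤ T / α := le_div_self (Nat.cast_nonneg T) hα hα1
  obtain rfl | hT := (ht₀1.trans ht₀T).eq_or_lt
  · have hlog : 0 ≤ Real.log ((1 : ℕ) / α) := Real.log_nonneg (by simpa using hTα)
    refine (Finset.sum_eq_zero fun t ht => ?_).trans_le (by positivity)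
    obtain ⟨ht1, htT⟩ := (Bandit.mem_subRounds.1 ht).1
    obtain rfl := le_antisymm htT ht1
    have hempty : {ω | a 1 n ω = i ∧ ¬ PrefError I best c a 1 n ω} = ∅ :=
      Set.eq_empty_of_forall_notMem fun ω hω =>
        hω.2 (prefError_one c (hbest 1 n) (hA.mem 1 n ω le_rfl))
    rw [hempty, measureReal_empty, mul_zero]
  · have hT2 : (2 : ℝ) ≤ T := by exact_mod_cast hT
    have hlog : 1 / 2 ≤ Real.log (T / α) := by
      linarith [Real.log_two_gt_d9, Real.log_le_log two_pos (hT2.trans hTα)]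
    have habsorb : I.delta ^ 2 / I.gapMin best T n i
        ≤ 2 * (I.delta ^ 2 * Real.log (T / α) / I.gapMin best T n i) := by
      rw [mul_div_assoc', div_le_div_iff_of_pos_right hy]
      nlinarith [sq_nonneg I.delta]
    linarith

end RewardRegret

section RegretBounds

variable {N K D : ℕ} {Ω : Type*}

open Classical in
/-- The regret of the pulls satisfying `Q`, a common form of `regretPref` and `regretReward`. -/
noncomputable def regretOn (I : Bandit N K D) (best : ℕ → Fin N → Fin K)
    (a : ℕ → Fin N → Ω → Fin K) (T : ℕ) (Q : ℕ → Fin N → Ω → Prop) (ω : Ω) : ℝ :=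
  ∑ t ∈ Finset.Icc 1 T, ∑ n : Fin N, if Q t n ω then I.gap best t n (a t n ω) else 0

theorem regretPref_eq_regretOn (I : Bandit N K D) (best : ℕ → Fin N → Fin K)
    (c : ℕ → Fin N → Ω → (Fin D → ℝ)) (a : ℕ → Fin N → Ω → Fin K) (T : ℕ) :
    regretPref I best c a T = regretOn I best a T (PrefError I best c a) :=
  rfl

theorem regretReward_eq_regretOn (I : Bandit N K D) (best : ℕ → Fin N → Fin K)
    (c : ℕ → Fin N → Ω → (Fin D → ℝ)) (a : ℕ → Fin N → Ω → Fin K) (T : ℕ) :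
    regretReward I best c a T
      = regretOn I best a T fun t n ω => ¬ PrefError I best c a t n ω := by
  funext ω
  unfold regretReward regretOn
  refine Finset.sum_congr rfl fun t _ => Finset.sum_congr rfl fun n _ => ?_
  split_ifs <;> first | rfl | contradiction

theorem regret_eq_regretReward_add_regretPref (I : Bandit N K D) (best : ℕ → Fin N → Fin K)
    (c : ℕ → Fin N → Ω → (Fin D → ℝ)) (a : ℕ → Fin N → Ω → Fin K) (T : ℕ) (ω : Ω) :
    regret I best a T ω = regretReward I best c a T ω + regretPref I best c a T ω := by
  simp only [regret, regretReward, regretPref, ← Finset.sum_add_distrib]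
  refine Finset.sum_congr rfl fun t _ => Finset.sum_congr rfl fun n _ => ?_
  split_ifs <;> simp

section Sorting

variable {I : Bandit N K D} {best : ℕ → Fin N → Fin K} {a : ℕ → Fin N → Ω → Fin K}

theorem regretOn_eq_sum_indicator (hbest : ∀ t n, I.IsBestArm t n (best t n))
    (hmem : ∀ t n ω, 1 ≤ t → a t n ω ∈ I.armSet t n) (T : ℕ) (Q : ℕ → Fin N → Ω → Prop) (ω : Ω) :
    regretOn I best a T Q ω
      = ∑ n : Fin N, ∑ i : Fin K with (I.subRounds best T n i).Nonempty,
        ∑ t ∈ I.subRounds best T n i,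
          {ω | a t n ω = i ∧ Q t n ω}.indicator (fun _ => I.gap best t n i) ω := by
  classical
  rw [regretOn, Finset.sum_comm]
  refine Finset.sum_congr rfl fun n _ => ?_
  rw [Finset.sum_filter_of_ne fun i _ hi => Finset.nonempty_of_sum_ne_zero hi]
  simp only [Bandit.subRounds, Finset.sum_filter]
  rw [Finset.sum_comm]
  refine Finset.sum_congr rfl fun t ht => ?_
  have hm := hmem t n ω (Finset.mem_Icc.1 ht).1
  rw [Finset.sum_eq_single (a t n ω)]
  · rcases (Bandit.gap_nonneg (hbest t n) hm).eq_or_lt with h | h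
    · simp [← h]
    · by_cases hQ : Q t n ω <;> simp [hQ, hm, h]
  · intro i _ hi
    have : ω ∉ {ω | a t n ω = i ∧ Q t n ω} := fun h => hi h.1.symm
    rw [Set.indicator_of_notMem this, ite_self]
  · simp

end Sorting

section Run

variable {𝒰 : MeasurableSpace Ω} [mΩ : MeasurableSpace Ω] {I : Bandit N K D}
  {P : Measure Ω} {α : ℝ}
  {r : ℕ → Fin N → Fin K → Ω → (Fin D → ℝ)} {c : ℕ → Fin N → Ω → (Fin D → ℝ)}
  {a : ℕ → Fin N → Ω → Fin K} {best : ℕ → Fin N → Fin K} {T : ℕ}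

theorem IsNonanticipating.measurableSet_prefError (hA : IsNonanticipating 𝒰 P r c a)
    (hE : IsEnvironment I P r c) (best : ℕ → Fin N → Fin K) {t : ℕ} (ht : 1 ≤ t) (n : Fin N) :
    MeasurableSet {ω | PrefError I best c a t n ω} := by
  have harm (f : Fin K → ℝ) : Measurable fun ω => f (a t n ω) :=
    (measurable_of_finite f).comp (hA.measurable_arm hE ht n)
  have hest : Measurable (prefEst c t n) := measurable_prefEst c t n fun s => hE.measurable_pref s n
  refine measurableSet_le (Finset.measurable_fun_sum _ fun d _ =>
    ((measurable_pi_apply d).comp hest).mul ?_) (harm fun i => I.gap best t n i / 2)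
  exact harm fun i => (I.meanReward (best t n) - I.meanReward i) d

variable {Q : ℕ → Fin N → Ω → Prop}

theorem IsNonanticipating.measurableSet_pull (hA : IsNonanticipating 𝒰 P r c a)
    (hE : IsEnvironment I P r c) (hQ : ∀ t n, 1 ≤ t → MeasurableSet {ω | Q t n ω}) {n : Fin N}
    {i : Fin K} {t : ℕ} (ht : t ∈ I.subRounds best T n i) :
    MeasurableSet {ω | a t n ω = i ∧ Q t n ω} :=
  have ht1 := (Bandit.mem_subRounds.1 ht).1.1
  (hA.measurable_arm hE ht1 n (measurableSet_singleton i)).inter (hQ t n ht1)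

variable [IsProbabilityMeasure P]

theorem IsNonanticipating.integrable_pull (hA : IsNonanticipating 𝒰 P r c a)
    (hE : IsEnvironment I P r c) (hQ : ∀ t n, 1 ≤ t → MeasurableSet {ω | Q t n ω}) {n : Fin N}
    {i : Fin K} {t : ℕ} (ht : t ∈ I.subRounds best T n i) :
    Integrable ({ω | a t n ω = i ∧ Q t n ω}.indicator fun _ => I.gap best t n i) P :=
  (integrable_const _).indicator (hA.measurableSet_pull hE hQ ht)

theorem integrable_regretOn (hE : IsEnvironment I P r c) (hA : IsPRUCBUP 𝒰 I P α r c a)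
    (hbest : ∀ t n, I.IsBestArm t n (best t n))
    (hQ : ∀ t n, 1 ≤ t → MeasurableSet {ω | Q t n ω}) :
    Integrable (regretOn I best a T Q) P := by
  rw [funext (regretOn_eq_sum_indicator hbest hA.mem T Q)]
  exact integrable_finsetSum _ fun n _ => integrable_finsetSum _ fun i _ =>
    integrable_finsetSum _ fun t ht => hA.isNonanticipating.integrable_pull hE hQ ht

theorem integral_regretOn (hE : IsEnvironment I P r c) (hA : IsPRUCBUP 𝒰 I P α r c a)
    (hbest : ∀ t n, I.IsBestArm t n (best t n))
    (hQ : ∀ t n, 1 ≤ t → MeasurableSet {ω | Q t n ω}) :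
    ∫ ω, regretOn I best a T Q ω ∂P
      = ∑ n : Fin N, ∑ i : Fin K with (I.subRounds best T n i).Nonempty,
        ∑ t ∈ I.subRounds best T n i,
          I.gap best t n i * P.real {ω | a t n ω = i ∧ Q t n ω} := by
  have hint (n : Fin N) (i : Fin K) (t : ℕ) (ht : t ∈ I.subRounds best T n i) :=
    hA.isNonanticipating.integrable_pull hE hQ ht
  simp only [regretOn_eq_sum_indicator hbest hA.mem T Q]
  rw [integral_finsetSum _ fun n _ => integrable_finsetSum _ fun i _ =>
    integrable_finsetSum _ (hint n i)]
  refine Finset.sum_congr rfl fun n _ => ?_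
  rw [integral_finsetSum _ fun i _ => integrable_finsetSum _ (hint n i)]
  refine Finset.sum_congr rfl fun i _ => ?_
  rw [integral_finsetSum _ (hint n i)]
  refine Finset.sum_congr rfl fun t ht => ?_
  rw [integral_indicator_const _ (hA.isNonanticipating.measurableSet_pull hE hQ ht), smul_eq_mul,
    mul_comm]

theorem integral_regret (hE : IsEnvironment I P r c) (hA : IsPRUCBUP 𝒰 I P α r c a)
    (hbest : ∀ t n, I.IsBestArm t n (best t n)) :
    ∫ ω, regret I best a T ω ∂P
      = ∫ ω, regretReward I best c a T ω ∂P + ∫ ω, regretPref I best c a T ω ∂P := by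
  have herr (t : ℕ) (n : Fin N) (ht : 1 ≤ t) :=
    hA.isNonanticipating.measurableSet_prefError hE best ht n
  simp only [regret_eq_regretReward_add_regretPref I best c, regretReward_eq_regretOn,
    regretPref_eq_regretOn]
  exact integral_add (integrable_regretOn hE hA hbest fun t n ht => (herr t n ht).compl)
    (integrable_regretOn hE hA hbest herr)

theorem integral_regretPref_le (hE : IsEnvironment I P r c) (hA : IsPRUCBUP 𝒰 I P α r c a)
    (hbest : ∀ t n, I.IsBestArm t n (best t n)) :
    ∫ ω, regretPref I best c a T ω ∂P ≤ 96 * I.prefBound best T := by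
  rw [regretPref_eq_regretOn, integral_regretOn hE hA hbest fun t n ht =>
    hA.isNonanticipating.measurableSet_prefError hE best ht n]
  simp only [Bandit.prefBound, Finset.mul_sum]
  exact Finset.sum_le_sum fun n _ => Finset.sum_le_sum fun i hi =>
    sum_gap_mul_prefError_le hE a hbest (Finset.mem_filter.1 hi).2

theorem integral_regretReward_le (hE : IsEnvironment I P r c) (hα : 0 < α) (hα1 : α ≤ 1)
    (hA : IsPRUCBUP 𝒰 I P α r c a) (hbest : ∀ t n, I.IsBestArm t n (best t n)) :
    ∫ ω, regretReward I best c a T ω ∂P ≤ 548 * I.rewardBound best T α (Real.log (T / α)) := by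
  have hmeas (t : ℕ) (n : Fin N) (ht : 1 ≤ t) : MeasurableSet {ω | ¬ PrefError I best c a t n ω} :=
    (hA.isNonanticipating.measurableSet_prefError hE best ht n).compl
  rw [regretReward_eq_regretOn, integral_regretOn hE hA hbest hmeas]
  simp only [Bandit.rewardBound, Finset.mul_sum]
  refine Finset.sum_le_sum fun n _ => Finset.sum_le_sum fun i hi => ?_
  have hne := (Finset.mem_filter.1 hi).2
  have := Bandit.gapMax_pos hne
  refine (sum_gap_mul_not_prefError_le hE hα hα1 hA hbest hne).trans ?_
  exact mul_le_mul_of_nonneg_left (le_add_of_nonneg_right (by positivity)) (by norm_num)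

end Run

section Bounds

variable (I : Bandit N K D) (best : ℕ → Fin N → Fin K) (T : ℕ) (α : ℝ) {L L' : ℝ}

theorem Bandit.prefBound_nonneg : 0 ≤ I.prefBound best T := by
  refine Finset.sum_nonneg fun n _ => Finset.sum_nonneg fun i hi => ?_
  have := Bandit.gapMin_pos (Finset.mem_filter.1 hi).2
  positivity

theorem Bandit.rewardBound_nonneg (hL : 0 ≤ L) : 0 ≤ I.rewardBound best T α L := by
  refine Finset.sum_nonneg fun n _ => Finset.sum_nonneg fun i hi => ?_
  have hne := (Finset.mem_filter.1 hi).2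
  have := Bandit.gapMin_pos hne
  have := Bandit.gapMax_pos hne
  positivity

theorem Bandit.rewardBound_le_two_mul (h : L ≤ 2 * L') :
    I.rewardBound best T α L ≤ 2 * I.rewardBound best T α L' := by
  simp only [Bandit.rewardBound, Finset.mul_sum]
  refine Finset.sum_le_sum fun n _ => Finset.sum_le_sum fun i hi => ?_
  have hne := (Finset.mem_filter.1 hi).2
  have := Bandit.gapMin_pos hne
  have := Bandit.gapMax_pos hne
  rw [mul_add]
  refine add_le_add ?_ (le_mul_of_one_le_left (by positivity) one_le_two)
  rw [mul_div_assoc', mul_left_comm]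
  gcongr

end Bounds

theorem log_div_le_two_mul_log {x α : ℝ} (hα : 0 < α) (h : 1 / α ≤ x) :
    Real.log (x / α) ≤ 2 * Real.log x := by
  have hx : 0 < x := (one_div_pos.2 hα).trans_le h
  rw [div_eq_mul_one_div, Real.log_mul hx.ne' (by positivity), two_mul]
  gcongr

end RegretBounds

end PAMO

theorem theorem2 :
    ∃ C : ℝ, 0 < C ∧
      ∀ (N K D : ℕ) (I : PAMO.Bandit N K D) (best : ℕ → Fin N → Fin K)
        (_ : ∀ t n, I.IsBestArm t n (best t n))
        (Ω : Type*) (𝒰 : MeasurableSpace Ω) [mΩ : MeasurableSpace Ω] (P : Measure Ω) [IsProbabilityMeasure P]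
        (r : ℕ → Fin N → Fin K → Ω → (Fin D → ℝ)) (c : ℕ → Fin N → Ω → (Fin D → ℝ))
        (_ : PAMO.IsEnvironment I P r c)
        (α : ℝ) (_ : 0 < α) (_ : α ≤ 1)
        (a : ℕ → Fin N → Ω → Fin K)
        (_ : PAMO.IsPRUCBUP 𝒰 I P α r c a)
        (T : ℕ) (_ : 1 ≤ T),
        -- the regret bound, with the dependence on the parameter of the algorithm explicit
        ∫ ω, PAMO.regret I best a T ω ∂P
            ≤ C * (I.rewardBound best T α (Real.log ((T : ℝ) / α)) + I.prefBound best T) ∧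
        -- the regret bound with `log T`, as soon as `T ≥ 1 / α`
        (1 / α ≤ (T : ℝ) →
          ∫ ω, PAMO.regret I best a T ω ∂P
            ≤ C * (I.rewardBound best T α (Real.log (T : ℝ)) + I.prefBound best T)) ∧
        -- the contributions of the two kinds of estimation errors
        (∀ ω, PAMO.regret I best a T ω
            = PAMO.regretReward I best c a T ω + PAMO.regretPref I best c a T ω) ∧
        ∫ ω, PAMO.regretReward I best c a T ω ∂P
            ≤ C * I.rewardBound best T α (Real.log ((T : ℝ) / α)) ∧
        ∫ ω, PAMO.regretPref I best c a T ω ∂P ≤ C * I.prefBound best T := by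
  refine ⟨1096, by norm_num, ?_⟩
  intro N K D I best hbest Ω 𝒰 mΩ P _ r c hE α hα hα1 a hA T hT
  have hlog : 0 ≤ Real.log ((T : ℝ) / α) :=
    Real.log_nonneg ((Nat.one_le_cast.2 hT).trans (le_div_self (Nat.cast_nonneg T) hα hα1))
  have hreward_nonneg := I.rewardBound_nonneg best T α hlog
  have hpref_nonneg := I.prefBound_nonneg best T
  have hreward := PAMO.integral_regretReward_le (T := T) hE hα hα1 hA hbest
  have hpref := PAMO.integral_regretPref_le (T := T) hE hA hbest
  have hregret := PAMO.integral_regret (T := T) hE hA hbest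
  refine ⟨by linarith, fun hTα => ?_, PAMO.regret_eq_regretReward_add_regretPref I best c a T,
    by linarith, by linarith⟩
  have := I.rewardBound_le_two_mul best T α (PAMO.log_div_le_two_mul_log hα hTα)
  linarith
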